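/- Let $f:\mathbb R^d\times\Xi\to\mathbb R$ be a measurable loss, differentiable in its first argument and integrable in its second with respect to the data distribution, and let $F(x)=\mathbb E_\xi[f(x,\xi)]$. Assume that 1. $F$ is differentiable with $\|\nabla F(x)-\nabla F(y)\|\le L\|x-y\|$ for all $x,y$, for some $L>0$, and $F^\star=\inf_x F(x)>-\infty$; 2. for every $x$ the per-point gradient noise $\nu_\xi(x)=\nabla f(x,\xi)-\nabla F(x)$ is absolutely continuous with respect to Lebesgue measure and has the same distribution as $-\nu_\xi(x)$; 3. $\sup_x\mathbb E\|\nu_\xi(x)\|^p\le\sigma^p$ for some $p>1$, $\sigma>0$. Let $\gamma\in(0,\tfrac12)$, $\theta\in(0,1)$, and let $M,R\ge1$ be integers with $M>\frac{2}{p\theta\gamma}$. *R-CSGD-Mini* with step size $\alpha$ and clipping threshold $\lambda$ starts at a deterministic $x^0\in\mathbb R^d$. At iteration $t=0,1,2,\dots$ it draws $MR$ fresh i.i.d. data points, independent of the past, splits them into $M$ chunks of size $R$, forms the chunk gradients $g_j^t=\frac1R\sum_{k=1}^R\nabla f(x^t,\xi^t_{j,k})$, selects the medoid index $j^\star=\operatorname{argmin}_j\sum_{i=1}^M\|g_i^t-g_j^t\|$,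 and sets $$x^{t+1}=x^t-\alpha\,\min\Big\{1,\frac{\lambda}{\|g_{j^\star}^t\|}\Big\}\,g_{j^\star}^t .$$ Here $\operatorname{argmin}$ is any fixed measurable rule that depends only on the values of the $M$ sums (e.g. the smallest minimizing index). Then the medoid noise $\nu_{j^\star}(x)=g_{j^\star}(x)-\nabla F(x)$ (for a fresh batch at the fixed point $x$) has a uniformly bounded second moment: there is $S_0>0$, depending only on $p,\sigma,\gamma,\theta,M,R$, with $\sup_x\mathbb E\|\nu_{j^\star}(x)\|^2\le S_0^2$. Moreover, let $S>0$ be any number with $\sup_x\mathbb E\|\nu_{j^\star}(x)\|^2\le S^2$. Let $\delta\in(0,1)$, $\tau=\max\{\log\frac1\delta,1\}$ and $\Delta=F(x^0)-F^\star$. For every horizon $T\ge1$, run R-CSGD-Mini with $$\lambda=\max\Big\{\frac{8\tau}{\sqrt{L\Delta}}\,S^2\,T^{1/4},\ 2\sqrt{90L\Delta},\ \sqrt{32}\,S\,T^{1/4}\Big\},\qquad \alpha=\frac{\sqrt{\Delta}\,T^{-1/4}}{8\lambda\sqrt L\,\tau}$$ (if $\Delta=0$, the first term in the maximum is read as $0$,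 and $\alpha=0$). Then, with probability at least $1-\delta$, $$\frac1T\sum_{t=0}^{T-1}\|\nabla F(x^t)\|^2\le 720\sqrt{\Delta L}\,\tau\max\Big\{\frac{8\tau}{\sqrt{L\Delta}}S^2T^{-1/2},\ 2\sqrt{90L\Delta}\,T^{-3/4},\ \sqrt{32}\,S\,T^{-1/2}\Big\}=\mathcal O(T^{-1/2}).$$ -/

import Mathlib

open MeasureTheory ProbabilityTheory Filter Asymptotics
open scoped Gradient ENNReal

noncomputable section

namespace RCSGD

variable {d M R : ℕ} {Ξ Ω : Type*} [MeasurableSpace Ξ]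

/-- The population loss `F(x) = 𝔼_ξ[f(x, ξ)]`, where `ξ` has law `D`. -/
def popLoss (D : Measure Ξ) (f : EuclideanSpace ℝ (Fin d) → Ξ → ℝ)
    (x : EuclideanSpace ℝ (Fin d)) : ℝ :=
  ∫ s, f x s ∂D

/-- The per-sample gradient `∇f(x, ξ)`, the gradient being taken in `x`. -/
def sampleGrad (f : EuclideanSpace ℝ (Fin d) → Ξ → ℝ) (x : EuclideanSpace ℝ (Fin d)) (s : Ξ) :
    EuclideanSpace ℝ (Fin d) :=
  ∇ (fun y => f y s) x

/-- The per-point gradient noise `ν_ξ(x) = ∇f(x, ξ) - ∇F(x)`. -/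
def noise (D : Measure Ξ) (f : EuclideanSpace ℝ (Fin d) → Ξ → ℝ)
    (x : EuclideanSpace ℝ (Fin d)) (s : Ξ) : EuclideanSpace ℝ (Fin d) :=
  sampleGrad f x s - ∇ (popLoss D f) x

/-- The loss is measurable, differentiable in the model parameter, and integrable in the data
point, so that the gradients and the population loss are meaningful. -/
structure IsLoss (D : Measure Ξ) (f : EuclideanSpace ℝ (Fin d) → Ξ → ℝ) : Prop where
  measurable : Measurable (Function.uncurry f)
  differentiable : ∀ s, Differentiable ℝ (fun x => f x s)
  integrable : ∀ x, Integrable (f x) D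

/-- `F` is `L`-smooth: differentiable with `L`-Lipschitz gradient. -/
structure IsSmooth (F : EuclideanSpace ℝ (Fin d) → ℝ) (L : ℝ) : Prop where
  differentiable : Differentiable ℝ F
  lipschitz : ∀ x y, ‖∇ F x - ∇ F y‖ ≤ L * ‖x - y‖

/-- The distributional assumptions on the per-point gradient noise: for every fixed `x` it is
absolutely continuous, symmetric, and its `p`-th absolute moment is at most `σ ^ p`. -/
structure IsNoise (D : Measure Ξ) (f : EuclideanSpace ℝ (Fin d) → Ξ → ℝ) (p σ : ℝ) : Prop where
  absolutelyContinuous : ∀ x, D.map (noise D f x) ≪ volume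
  symmetric : ∀ x, D.map (noise D f x) = D.map (fun s => -noise D f x s)
  moment : ∀ x, ∫⁻ s, ‖noise D f x s‖ₑ ^ p ∂D ≤ ENNReal.ofReal σ ^ p

/-- The stochastic gradient `(1/R) ∑ₖ ∇f(x, ξ_{jₖ})` of the chunk `j` of a batch of `K = M R`
data points, the `k`-th point of chunk `j` being `b (j, k)`. -/
def chunkGrad (f : EuclideanSpace ℝ (Fin d) → Ξ → ℝ) (b : Fin M × Fin R → Ξ)
    (x : EuclideanSpace ℝ (Fin d)) (j : Fin M) : EuclideanSpace ℝ (Fin d) :=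
  (1 / (R : ℝ)) • ∑ k, sampleGrad f x (b (j, k))

/-- An `argmin` operation on finite lists of reals: it returns an index of a smallest entry.
How ties are resolved is left open, but the resolution depends on the list alone
(for instance: the smallest minimizing index). -/
structure IsArgmin (am : (Fin M → ℝ) → Fin M) : Prop where
  measurable : Measurable am
  le : ∀ (v : Fin M → ℝ) (j : Fin M), v (am v) ≤ v j

/-- The medoid `g_{j⋆}` of `g₁, …, g_M`, with `j⋆ = argmin_j ∑ᵢ ‖gᵢ - gⱼ‖`. -/
def medoid (am : (Fin M → ℝ) → Fin M) (g : Fin M → EuclideanSpace ℝ (Fin d)) :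
    EuclideanSpace ℝ (Fin d) :=
  g (am (fun j => ∑ i, ‖g i - g j‖))

/-- The medoid of the chunk gradients of the batch `b` at the point `x`. -/
def medoidGrad (am : (Fin M → ℝ) → Fin M) (f : EuclideanSpace ℝ (Fin d) → Ξ → ℝ)
    (b : Fin M × Fin R → Ξ) (x : EuclideanSpace ℝ (Fin d)) : EuclideanSpace ℝ (Fin d) :=
  medoid am (chunkGrad f b x)

/-- The second moment `𝔼 ‖ν_{j⋆}(x)‖²` of the medoid noise `ν_{j⋆}(x) = ∇f_{j⋆}(x) - ∇F(x)`
at `x`, for a batch of `M R` independent data points with law `D`. -/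
def medoidNoiseMoment (R : ℕ) (am : (Fin M → ℝ) → Fin M) (D : Measure Ξ)
    (f : EuclideanSpace ℝ (Fin d) → Ξ → ℝ) (x : EuclideanSpace ℝ (Fin d)) : ℝ≥0∞ :=
  ∫⁻ b, ‖medoidGrad am f b x - ∇ (popLoss D f) x‖ₑ ^ 2
    ∂(Measure.pi fun _ : Fin M × Fin R => D)

/-- The clipping operator `min {1, lam / ‖g‖} g`. -/
def clip (lam : ℝ) (g : EuclideanSpace ℝ (Fin d)) : EuclideanSpace ℝ (Fin d) :=
  min 1 (lam / ‖g‖) • g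

/-- The iterates of R-CSGD-Mini with constant step size `α` and clipping threshold `lam`,
started at `x₀`; `data t` is the batch of `M R` data points drawn at iteration `t`. -/
def iterate (am : (Fin M → ℝ) → Fin M) (f : EuclideanSpace ℝ (Fin d) → Ξ → ℝ) (α lam : ℝ)
    (x₀ : EuclideanSpace ℝ (Fin d)) (data : ℕ → Fin M × Fin R → Ω → Ξ) :
    ℕ → Ω → EuclideanSpace ℝ (Fin d)
  | 0, _ => x₀
  | t + 1, ω =>
    iterate am f α lam x₀ data t ω -
      α • clip lam (medoidGrad am f (fun i => data t i ω) (iterate am f α lam x₀ data t ω))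

/-- `τ = max {log (1/δ), 1}`. -/
def tau (δ : ℝ) : ℝ := max (Real.log (1 / δ)) 1

/-- The clipping threshold for noise whose moment of order `q` is at most `s ^ q`, smoothness `L`,
initial gap `Δ`, confidence `1 - δ` and horizon `T`. -/
def threshold (q L Δ s δ : ℝ) (T : ℕ) : ℝ :=
  max (max ((8 * tau δ / √(L * Δ)) ^ (1 / (q - 1)) * (T : ℝ) ^ (1 / (3 * q - 2)) *
        s ^ (q / (q - 1)))
      (2 * √(90 * L * Δ)))
    ((32 : ℝ) ^ (1 / q) * s * (T : ℝ) ^ (1 / (3 * q - 2)))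

/-- The step size belonging to `threshold`. -/
def stepSize (q L Δ s δ : ℝ) (T : ℕ) : ℝ :=
  √Δ * (T : ℝ) ^ ((1 - q) / (3 * q - 2)) / (8 * threshold q L Δ s δ T * √L * tau δ)

/-- The high-probability bound belonging to `threshold` and `stepSize`. -/
def rateBound (q L Δ s δ : ℝ) (T : ℕ) : ℝ :=
  720 * √(Δ * L) * tau δ *
    max (max ((8 * tau δ / √(L * Δ)) ^ (1 / (q - 1)) * (T : ℝ) ^ ((2 - 2 * q) / (3 * q - 2)) *
          s ^ (q / (q - 1)))
        (2 * √(90 * L * Δ) * (T : ℝ) ^ ((1 - 2 * q) / (3 * q - 2))))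
      ((32 : ℝ) ^ (1 / q) * s * (T : ℝ) ^ ((2 - 2 * q) / (3 * q - 2)))

end RCSGD

end

/-! Two independent arguments meet in the variance bound `S`.

Noise. If at most a fraction `γ < 1/2` of the points lie outside a ball of radius `r` about the
origin, the medoid has norm at most `3 / (1 - 2γ) * r` (`norm_medoid_le`). Hence, with `m = ⌊γM⌋ +
1`, at least `m` chunk means are as long as the medoid up to this factor. They come from different
chunks, so the squared medoid is bounded by a product of `m` independent norms, each raised to the
power `2 / m`. Since `m p ≥ 2`, moments of order `p` bound its expectation (`medoidNoiseMoment_le`).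
The medoid is an odd function of the noise, so symmetry makes it centred
(`integral_medoidNoise_eq_zero`). From here on it is noise with mean zero and finite variance,
whatever `p > 1` is.

Optimization. Where `F - F⋆ ≤ 45Δ`, smoothness gives `‖∇F‖² ≤ 90LΔ`, so the gradient is at most `λ /
2` and clipping biases the step by at most `‖ν‖² / (2λ)`. Consider the potential `exp (η (F(xᵗ) - F⋆
+ α/2 ∑_{s<t} ‖∇F(xˢ)‖²))`. Conditionally on the past, a step from such a point multiplies its mean
by at most `exp (ηε)` (`lintegral_exp_stepExcess_le`). The run is frozen once it leaves the sublevel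
set, so this holds at every step. With `Tε ≤ 4Δ`, Markov's inequality bounds the probability that
the exponent reaches `45ηΔ` by `exp (-40ηΔ)`. Otherwise the run was never frozen and `α/2 ∑ ‖∇F‖² <
45Δ` (`measure_sum_gradient_sq_gt_le`). The choice `η = τ / (40Δ)` makes the failure probability
`exp (-τ) ≤ δ`, and `90Δ / (αT)` is exactly the stated rate. -/

namespace RCSGD

/-! ### Smooth functions. -/

section Smooth

variable {E : Type*} [NormedAddCommGroup E] [InnerProductSpace ℝ E] [CompleteSpace E]

/-- The descent lemma for functions with Lipschitz gradient. -/
theorem le_add_inner_add_of_lipschitz_gradient {F : E → ℝ} {L : ℝ} (hF : Differentiable ℝ F)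
    (hL : ∀ x y, ‖∇ F x - ∇ F y‖ ≤ L * ‖x - y‖) (x v : E) :
    F (x + v) ≤ F x + inner ℝ (∇ F x) v + L / 2 * ‖v‖ ^ 2 := by
  -- Gap between `F` and its quadratic upper model along the segment; the Lipschitz bound gives `φ'
  -- ≤ 0`, and `φ 1 ≤ φ 0` is the claim.
  let φ : ℝ → ℝ := fun t => F (x + t • v) - t * inner ℝ (∇ F x) v - L / 2 * ‖v‖ ^ 2 * t ^ 2
  have hφ : ∀ t, HasDerivAt φ
      (inner ℝ (∇ F (x + t • v)) v - inner ℝ (∇ F x) v - L * ‖v‖ ^ 2 * t) t := by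
    intro t
    have h1 : HasDerivAt (fun t : ℝ => x + t • v) v t := by
      simpa using ((hasDerivAt_id t).smul_const v).const_add x
    have h2 := (hF (x + t • v)).hasGradientAt.hasFDerivAt.comp_hasDerivAt t h1
    have h3 := (h2.sub ((hasDerivAt_id t).mul_const (inner ℝ (∇ F x) v))).sub
      (((hasDerivAt_id t).pow 2).const_mul (L / 2 * ‖v‖ ^ 2))
    refine h3.congr_deriv ?_
    simp
    ring
  have hanti : AntitoneOn φ (Set.Icc 0 1) := by
    refine antitoneOn_of_deriv_nonpos (convex_Icc 0 1)
      (fun t _ => (hφ t).continuousAt.continuousWithinAt)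
      (fun t _ => (hφ t).differentiableAt.differentiableWithinAt) fun t ht => ?_
    rw [interior_Icc] at ht
    rw [(hφ t).deriv]
    have h1 : inner ℝ (∇ F (x + t • v) - ∇ F x) v ≤ L * (t * ‖v‖) * ‖v‖ := by
      refine (real_inner_le_norm _ _).trans ?_
      gcongr
      simpa [norm_smul, abs_of_pos ht.1] using hL (x + t • v) x
    rw [inner_sub_left] at h1
    nlinarith
  have h := hanti (Set.left_mem_Icc.2 zero_le_one) (Set.right_mem_Icc.2 zero_le_one) zero_le_one
  simp only [φ, one_smul, zero_smul, add_zero] at h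
  linarith

/-- The gradient of a smooth function is controlled by the suboptimality gap. -/
theorem norm_gradient_sq_le {F : E → ℝ} {L c : ℝ} (hF : Differentiable ℝ F) (hpos : 0 < L)
    (hL : ∀ x y, ‖∇ F x - ∇ F y‖ ≤ L * ‖x - y‖) (hc : ∀ x, c ≤ F x) (x : E) :
    ‖∇ F x‖ ^ 2 ≤ 2 * L * (F x - c) := by
  -- This step minimizes the quadratic upper model at `x`.
  have h := le_add_inner_add_of_lipschitz_gradient hF hL x (-(1 / L) • ∇ F x)
  have h' := hc (x + -(1 / L) • ∇ F x)
  rw [inner_smul_right, real_inner_self_eq_norm_sq, norm_smul, mul_pow, Real.norm_eq_abs,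
    sq_abs] at h
  have e : -(1 / L) * ‖∇ F x‖ ^ 2 + L / 2 * ((-(1 / L)) ^ 2 * ‖∇ F x‖ ^ 2)
      = -(‖∇ F x‖ ^ 2 / (2 * L)) := by
    field_simp
    ring
  have h2 : ‖∇ F x‖ ^ 2 / (2 * L) ≤ F x - c := by linarith
  rw [div_le_iff₀ (by positivity)] at h2
  linarith

end Smooth

/-! ### Measurability, equivariance and robustness of the medoid. -/

variable {d M R : ℕ} {Ξ : Type*} [MeasurableSpace Ξ]

theorem IsSmooth.continuous_gradient {F : EuclideanSpace ℝ (Fin d) → ℝ} {L : ℝ}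
    (hF : IsSmooth F L) : Continuous (∇ F) :=
  (LipschitzWith.of_dist_le_mul (K := L.toNNReal) fun x y => by
    rw [dist_eq_norm, dist_eq_norm]
    refine (hF.lipschitz x y).trans ?_
    gcongr
    exact Real.le_coe_toNNReal L).continuous

/-- The per-sample gradient is jointly measurable, as a limit of difference quotients. -/
theorem IsLoss.measurable_sampleGrad {D : Measure Ξ} {f : EuclideanSpace ℝ (Fin d) → Ξ → ℝ}
    (hf : IsLoss D f) :
    Measurable (fun q : EuclideanSpace ℝ (Fin d) × Ξ => sampleGrad f q.1 q.2) := by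
  refine (measurable_pi_iff.2 fun i => ?_ :
    Measurable fun q => WithLp.ofLp (sampleGrad f (Prod.fst q) (Prod.snd q))) |> fun h =>
      (WithLp.measurable_toLp 2 _).comp h
  let e : EuclideanSpace ℝ (Fin d) := EuclideanSpace.single i 1
  let u : ℕ → EuclideanSpace ℝ (Fin d) × Ξ → ℝ := fun n q =>
    ((1 : ℝ) / (n + 1))⁻¹ • (f (q.1 + ((1 : ℝ) / (n + 1)) • e) q.2 - f q.1 q.2)
  refine measurable_of_tendsto_metrizable (f := u) (fun n => ?_) ?_
  · have h1 : Measurable fun q : EuclideanSpace ℝ (Fin d) × Ξ =>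
        f (q.1 + ((1 : ℝ) / (n + 1)) • e) q.2 :=
      hf.measurable.comp ((measurable_fst.add_const _).prodMk measurable_snd)
    exact (h1.sub hf.measurable).const_smul ((1 : ℝ) / (n + 1))⁻¹
  · refine tendsto_pi_nhds.2 fun q => ?_
    have h1 : HasDerivAt (fun t : ℝ => q.1 + t • e) e 0 := by
      simpa using ((hasDerivAt_id (0 : ℝ)).smul_const e).const_add q.1
    have h2 : HasFDerivAt (fun y => f y q.2)
        (InnerProductSpace.toDual ℝ _ (sampleGrad f q.1 q.2)) (q.1 + (0 : ℝ) • e) := by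
      simpa [sampleGrad] using (hf.differentiable q.2 q.1).hasGradientAt.hasFDerivAt
    have h3 := (h2.comp_hasDerivAt (0 : ℝ) h1).tendsto_slope_zero
    have h4 : Tendsto (fun n : ℕ => (1 : ℝ) / (n + 1)) atTop (nhdsWithin 0 {0}ᶜ) :=
      tendsto_nhdsWithin_iff.2 ⟨tendsto_one_div_add_atTop_nhds_zero_nat,
        Eventually.of_forall fun n => by simp; positivity⟩
    have h5 := h3.comp h4
    simpa [u, e, Function.comp_def, EuclideanSpace.inner_single_right] using h5

theorem IsArgmin.measurable_medoid {am : (Fin M → ℝ) → Fin M} (ham : IsArgmin am) :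
    Measurable (medoid am : (Fin M → EuclideanSpace ℝ (Fin d)) → EuclideanSpace ℝ (Fin d)) := by
  have h1 : Measurable fun q : (Fin M → EuclideanSpace ℝ (Fin d)) × Fin M => q.1 q.2 :=
    measurable_from_prod_countable_left fun j => measurable_pi_apply j
  have h2 : Measurable fun g : Fin M → EuclideanSpace ℝ (Fin d) =>
      am (fun j => ∑ i, ‖g i - g j‖) := by
    refine ham.measurable.comp (measurable_pi_iff.2 fun j => ?_)
    exact Finset.measurable_sum _ fun i _ =>
      ((measurable_pi_apply i).sub (measurable_pi_apply j)).norm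
  exact h1.comp (measurable_id.prodMk h2)

theorem measurable_medoidGrad {D : Measure Ξ} {f : EuclideanSpace ℝ (Fin d) → Ξ → ℝ}
    {am : (Fin M → ℝ) → Fin M} (hf : IsLoss D f) (ham : IsArgmin am) :
    Measurable fun q : EuclideanSpace ℝ (Fin d) × (Fin M × Fin R → Ξ) =>
      medoidGrad am f q.2 q.1 := by
  refine ham.measurable_medoid.comp (measurable_pi_iff.2 fun j => ?_)
  refine (Finset.measurable_sum _ fun k _ => ?_).const_smul (1 / (R : ℝ))
  exact hf.measurable_sampleGrad.comp
    (measurable_fst.prodMk ((measurable_pi_apply (j, k)).comp measurable_snd))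

theorem measurable_clip (lam : ℝ) :
    Measurable (clip lam : EuclideanSpace ℝ (Fin d) → EuclideanSpace ℝ (Fin d)) :=
  (measurable_const.min (measurable_const.div measurable_norm)).smul measurable_id

/-- Translating all points translates the medoid. -/
theorem medoid_sub (am : (Fin M → ℝ) → Fin M) (g : Fin M → EuclideanSpace ℝ (Fin d))
    (c : EuclideanSpace ℝ (Fin d)) : medoid am (fun j => g j - c) = medoid am g - c := by
  simp [medoid]

/-- Reflecting all points reflects the medoid. -/
theorem medoid_neg (am : (Fin M → ℝ) → Fin M) (g : Fin M → EuclideanSpace ℝ (Fin d)) :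
    medoid am (fun j => -g j) = -medoid am g := by
  have h : ∀ i j, ‖-g i - -g j‖ = ‖g i - g j‖ := fun i j => by
    rw [neg_sub_neg, norm_sub_rev]
  -- `am` sees only the sums, which reflection preserves, so the same index is selected even in case
  -- of ties.
  simp only [medoid, h]

/-- The averages of the chunks of a family of vectors. -/
noncomputable def chunkMean (v : Fin M × Fin R → EuclideanSpace ℝ (Fin d)) (j : Fin M) :
    EuclideanSpace ℝ (Fin d) :=
  (1 / (R : ℝ)) • ∑ k, v (j, k)

theorem measurable_chunkMean (j : Fin M) :
    Measurable fun v : Fin M × Fin R → EuclideanSpace ℝ (Fin d) => chunkMean v j :=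
  (Finset.measurable_sum _ fun k _ => measurable_pi_apply (j, k)).const_smul (1 / (R : ℝ))

/-- The medoid noise is the medoid of the chunk means of the per-point noise. -/
theorem medoidGrad_sub_gradient (hR : 0 < R) (am : (Fin M → ℝ) → Fin M) (D : Measure Ξ)
    (f : EuclideanSpace ℝ (Fin d) → Ξ → ℝ) (b : Fin M × Fin R → Ξ)
    (x : EuclideanSpace ℝ (Fin d)) :
    medoidGrad am f b x - ∇ (popLoss D f) x =
      medoid am (chunkMean fun i => noise D f x (b i)) := by
  rw [medoidGrad, ← medoid_sub]
  congr 1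
  ext1 j
  have hR' : (R : ℝ) ≠ 0 := by positivity
  simp only [chunkGrad, chunkMean, noise, Finset.sum_sub_distrib, Finset.sum_const,
    Finset.card_univ, Fintype.card_fin, smul_sub, ← Nat.cast_smul_eq_nsmul ℝ, smul_smul]
  rw [one_div_mul_cancel hR', one_smul]

/-- If all but a fraction of the points lie within distance `r` of the origin, so does the medoid
up to a constant factor. -/
theorem norm_medoid_le {am : (Fin M → ℝ) → Fin M} (ham : IsArgmin am)
    (n : Fin M → EuclideanSpace ℝ (Fin d)) {γ r : ℝ} (hγ : γ < 1 / 2) (hM : 0 < M) (hr : 0 ≤ r)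
    (h : ((Finset.univ.filter fun i => r < ‖n i‖).card : ℝ) ≤ γ * M) :
    ‖medoid am n‖ ≤ 3 / (1 - 2 * γ) * r := by
  classical
  have hM' : (0 : ℝ) < M := by positivity
  set B := Finset.univ.filter fun i => r < ‖n i‖ with hB
  set G := Finset.univ.filter fun i => ¬ r < ‖n i‖ with hG
  have hcard : (B.card : ℝ) + G.card = M := by
    have := Finset.card_filter_add_card_filter_not (s := (Finset.univ : Finset (Fin M)))
      (fun i => r < ‖n i‖)
    rw [Finset.card_univ, Fintype.card_fin] at this
    exact_mod_cast this
  have hGpos : (0 : ℝ) < G.card := by nlinarith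
  obtain ⟨k, hk⟩ := Finset.card_pos.1 (Nat.cast_pos.1 hGpos)
  have hkr : ‖n k‖ ≤ r := not_lt.1 (Finset.mem_filter.1 hk).2
  set a := ‖medoid am n‖ with ha
  have hmin := ham.le (fun j => ∑ i, ‖n i - n j‖) k
  change ∑ i, ‖n i - medoid am n‖ ≤ ∑ i, ‖n i - n k‖ at hmin
  rw [← Finset.sum_filter_add_sum_filter_not _ (fun i => r < ‖n i‖),
    ← Finset.sum_filter_add_sum_filter_not _ (fun i => r < ‖n i‖) (fun i => ‖n i - n k‖),
    ← hB, ← hG] at hmin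
  have h1 : ∑ i ∈ G, ‖n i - n k‖ ≤ G.card * (2 * r) := by
    rw [← nsmul_eq_mul]
    refine Finset.sum_le_card_nsmul _ _ _ fun i hi => ?_
    have := not_lt.1 (Finset.mem_filter.1 hi).2
    linarith [norm_sub_le (n i) (n k)]
  have h2 : (G.card : ℝ) * (a - r) ≤ ∑ i ∈ G, ‖n i - medoid am n‖ := by
    rw [← nsmul_eq_mul]
    refine Finset.card_nsmul_le_sum _ _ _ fun i hi => ?_
    have := not_lt.1 (Finset.mem_filter.1 hi).2
    have h3 := norm_sub_norm_le (medoid am n) (n i)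
    rw [norm_sub_rev] at h3
    linarith
  have h3 : ∑ i ∈ B, ‖n i - n k‖ ≤ ∑ i ∈ B, ‖n i - medoid am n‖ + B.card * (a + r) := by
    rw [← nsmul_eq_mul, ← Finset.sum_const, ← Finset.sum_add_distrib]
    refine Finset.sum_le_sum fun i _ => ?_
    have := norm_sub_le_norm_sub_add_norm_sub (n i) (medoid am n) (n k)
    linarith [norm_sub_le (medoid am n) (n k)]
  -- Minimality reads `|G|(a - r) ≤ 2r|G| + |B|(a + r)`: the terms `‖n i - medoid‖` with `i ∈ B`,
  -- which have no bound, cancel.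
  have h4 : ((G.card : ℝ) - B.card) * a ≤ 3 * M * r := by
    nlinarith [mul_nonneg B.card.cast_nonneg hr]
  have hden : 0 < 1 - 2 * γ := by linarith
  have h5 : M * (1 - 2 * γ) * a ≤ M * (3 * r) := by
    refine le_trans ?_ (h4.trans (by linarith))
    refine mul_le_mul_of_nonneg_right ?_ (norm_nonneg _)
    linarith
  rw [div_mul_eq_mul_div, le_div_iff₀ hden]
  have h6 : (1 - 2 * γ) * a ≤ 3 * r := by
    rw [mul_assoc] at h5
    exact le_of_mul_le_mul_left h5 hM'
  linarith

/-- The medoid is dominated by the `m` largest points, if `m` exceeds a suitable fraction of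
all points. -/
theorem exists_powersetCard_norm_medoid_le {am : (Fin M → ℝ) → Fin M} (ham : IsArgmin am)
    (n : Fin M → EuclideanSpace ℝ (Fin d)) {γ : ℝ} (hγ : γ < 1 / 2) {m : ℕ}
    (hm : 0 < m) (hmM : m ≤ M) (hmγ : (m : ℝ) ≤ γ * M + 1) :
    ∃ A ∈ Finset.powersetCard m (Finset.univ : Finset (Fin M)),
      ∀ i ∈ A, ‖medoid am n‖ ≤ 3 / (1 - 2 * γ) * ‖n i‖ := by
  classical
  have hden : 0 < 1 - 2 * γ := by linarith
  set a := ‖medoid am n‖ / (3 / (1 - 2 * γ)) with ha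
  have hC : 0 < 3 / (1 - 2 * γ) := by positivity
  have key : m ≤ (Finset.univ.filter fun i => a ≤ ‖n i‖).card := by
    by_contra! hlt
    -- the largest norm below `a` would contradict the previous lemma
    set s := Finset.univ.filter fun i => ¬ a ≤ ‖n i‖ with hs
    have hne : s.Nonempty := by
      rw [← Finset.card_pos]
      have := Finset.card_filter_add_card_filter_not (s := (Finset.univ : Finset (Fin M)))
        (fun i => a ≤ ‖n i‖)
      rw [Finset.card_univ, Fintype.card_fin] at this
      rw [hs]
      omega
    obtain ⟨k, hk, hmax⟩ := s.exists_max_image (fun i => ‖n i‖) hne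
    have hka : ‖n k‖ < a := not_le.1 (Finset.mem_filter.1 hk).2
    have hsub : (Finset.univ.filter fun i => ‖n k‖ < ‖n i‖) ⊆
        Finset.univ.filter fun i => a ≤ ‖n i‖ := by
      intro i hi
      rw [Finset.mem_filter] at hi ⊢
      refine ⟨Finset.mem_univ i, ?_⟩
      by_contra hcon
      exact absurd (hmax i (Finset.mem_filter.2 ⟨Finset.mem_univ i, hcon⟩)) (not_le.2 hi.2)
    have hc := Finset.card_le_card hsub
    -- At most `m - 1 ≤ γM` points are longer than `n k`, so the radius `‖n k‖ < a` is admissible.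
    have := norm_medoid_le ham n hγ (by omega) (norm_nonneg (n k)) (by
      have : ((Finset.univ.filter fun i => ‖n k‖ < ‖n i‖).card : ℝ) + 1 ≤ m := by
        exact_mod_cast (by omega : (Finset.univ.filter fun i => ‖n k‖ < ‖n i‖).card + 1 ≤ m)
      linarith)
    rw [ha, lt_div_iff₀ hC] at hka
    linarith
  obtain ⟨A, hA, hAm⟩ := Finset.exists_subset_card_eq key
  refine ⟨A, Finset.mem_powersetCard.2 ⟨Finset.subset_univ A, hAm⟩, fun i hi => ?_⟩
  have := (Finset.mem_filter.1 (hA hi)).2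
  rw [ha, div_le_iff₀ hC] at this
  linarith

end RCSGD

/-! ### Second moment and centring of the medoid noise. -/

namespace RCSGD

variable {d M R : ℕ} {Ξ : Type*} [MeasurableSpace Ξ]

theorem IsLoss.measurable_noise {D : Measure Ξ} {f : EuclideanSpace ℝ (Fin d) → Ξ → ℝ}
    (hf : IsLoss D f) (x : EuclideanSpace ℝ (Fin d)) : Measurable (noise D f x) :=
  (hf.measurable_sampleGrad.comp measurable_prodMk_left).sub_const _

/-- The moments of lower order of the noise. -/
theorem IsNoise.lintegral_rpow_le {D : Measure Ξ} [IsProbabilityMeasure D]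
    {f : EuclideanSpace ℝ (Fin d) → Ξ → ℝ} {p σ r : ℝ} (hf : IsLoss D f) (hn : IsNoise D f p σ)
    (hr : 0 < r) (hrp : r ≤ p) (x : EuclideanSpace ℝ (Fin d)) :
    ∫⁻ s, ‖noise D f x s‖ₑ ^ r ∂D ≤ ENNReal.ofReal σ ^ r := by
  have hp : 0 < p := hr.trans_le hrp
  have h := eLpNorm'_le_eLpNorm'_of_exponent_le hr hrp D
    (hf.measurable_noise x).aestronglyMeasurable
  have h2 : eLpNorm' (noise D f x) p D ≤ ENNReal.ofReal σ := by
    rw [eLpNorm', one_div, ENNReal.rpow_inv_le_iff hp]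
    exact hn.moment x
  rw [lintegral_rpow_enorm_eq_rpow_eLpNorm' hr]
  exact ENNReal.rpow_le_rpow (h.trans h2) hr.le

/-- An average is no longer than its longest term. Keeping one point per chunk turns the bound on
chunk means into one on single samples, which are independent for a fixed `κ`. -/
theorem exists_norm_chunkMean_le (hR : 0 < R) (v : Fin M × Fin R → EuclideanSpace ℝ (Fin d)) :
    ∃ κ : Fin M → Fin R, ∀ j, ‖chunkMean v j‖ ≤ ‖v (j, κ j)‖ := by
  have : Nonempty (Fin R) := ⟨⟨0, hR⟩⟩
  have hR' : (0 : ℝ) < R := by positivity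
  refine ⟨fun j => (Finite.exists_max fun k => ‖v (j, k)‖).choose, fun j => ?_⟩
  have hmax := (Finite.exists_max fun k => ‖v (j, k)‖).choose_spec
  set k₀ := (Finite.exists_max fun k => ‖v (j, k)‖).choose
  have h1 : ‖∑ k, v (j, k)‖ ≤ R * ‖v (j, k₀)‖ := by
    refine (norm_sum_le _ _).trans ?_
    simpa using Finset.sum_le_card_nsmul Finset.univ _ _ fun k _ => hmax k
  rw [chunkMean, norm_smul, Real.norm_of_nonneg (by positivity), one_div, inv_mul_le_iff₀ hR']
  exact h1

/-- The square of the medoid of chunk means is dominated by products of fractional powers of the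
norms of points that lie in different chunks. -/
theorem enorm_medoid_sq_le {am : (Fin M → ℝ) → Fin M} (ham : IsArgmin am) (hR : 0 < R)
    (v : Fin M × Fin R → EuclideanSpace ℝ (Fin d)) {γ : ℝ} (hγ : γ < 1 / 2) {m : ℕ}
    (hm : 0 < m) (hmM : m ≤ M) (hmγ : (m : ℝ) ≤ γ * M + 1) :
    ‖medoid am (chunkMean v)‖ₑ ^ 2 ≤ ENNReal.ofReal (3 / (1 - 2 * γ)) ^ 2 *
      ∑ A ∈ Finset.powersetCard m (Finset.univ : Finset (Fin M)), ∑ κ : Fin M → Fin R,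
        ∏ j ∈ A, ‖v (j, κ j)‖ₑ ^ (2 / (m : ℝ)) := by
  obtain ⟨A, hA, hle⟩ := exists_powersetCard_norm_medoid_le ham (chunkMean v) hγ hm hmM hmγ
  obtain ⟨κ, hκ⟩ := exists_norm_chunkMean_le hR v
  set C := 3 / (1 - 2 * γ) with hC
  have hCpos : 0 < C := div_pos three_pos (by linarith)
  have hm' : (0 : ℝ) < m := by positivity
  have h1 : ∀ j ∈ A, ‖medoid am (chunkMean v)‖ₑ ≤ ENNReal.ofReal C * ‖v (j, κ j)‖ₑ := by
    intro j hj
    rw [← ofReal_norm, ← ofReal_norm, ← ENNReal.ofReal_mul hCpos.le]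
    exact ENNReal.ofReal_le_ofReal ((hle j hj).trans (by gcongr; exact hκ j))
  -- The square is spread evenly over the `m` chunks of `A`, so each norm enters only with the power
  -- `2 / m`.
  have hpow : ∀ a : ℝ≥0∞, ∏ _j ∈ A, a ^ (2 / (m : ℝ)) = a ^ 2 := by
    intro a
    rw [Finset.prod_const, (Finset.mem_powersetCard.1 hA).2, ← ENNReal.rpow_mul_natCast,
      div_mul_cancel₀ _ hm'.ne', ENNReal.rpow_two]
  calc ‖medoid am (chunkMean v)‖ₑ ^ 2
      ≤ ∏ j ∈ A, (ENNReal.ofReal C * ‖v (j, κ j)‖ₑ) ^ (2 / (m : ℝ)) := by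
        rw [← hpow]
        exact Finset.prod_le_prod' fun j hj => ENNReal.rpow_le_rpow (h1 j hj) (by positivity)
    _ = ENNReal.ofReal C ^ 2 * ∏ j ∈ A, ‖v (j, κ j)‖ₑ ^ (2 / (m : ℝ)) := by
        rw [← hpow, ← Finset.prod_mul_distrib]
        exact Finset.prod_congr rfl fun j _ => ENNReal.mul_rpow_of_nonneg _ _ (by positivity)
    -- `A` and `κ` depend on `v`; summing over all choices gives a bound with deterministic indices,
    -- which can be integrated termwise.
    _ ≤ _ := by
        gcongr
        refine le_trans ?_ (Finset.single_le_sum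
          (f := fun A => ∑ κ : Fin M → Fin R, ∏ j ∈ A, ‖v (j, κ j)‖ₑ ^ (2 / (m : ℝ)))
          (fun _ _ => zero_le) hA)
        exact Finset.single_le_sum (f := fun κ : Fin M → Fin R =>
          ∏ j ∈ A, ‖v (j, κ j)‖ₑ ^ (2 / (m : ℝ))) (fun _ _ => zero_le) (Finset.mem_univ κ)

/-- The medoid noise has a second moment that is bounded in terms of the moment of order `p` of
the per-point noise, provided that `m` with `m p ≥ 2` is within the breakdown point. -/
theorem medoidNoiseMoment_le {D : Measure Ξ} [IsProbabilityMeasure D]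
    {f : EuclideanSpace ℝ (Fin d) → Ξ → ℝ} {am : (Fin M → ℝ) → Fin M} {p σ γ : ℝ}
    (hf : IsLoss D f) (hn : IsNoise D f p σ) (ham : IsArgmin am) (hR : 0 < R) (hσ : 0 < σ)
    (hγ : γ < 1 / 2) {m : ℕ} (hm : 0 < m) (hmM : m ≤ M) (hmγ : (m : ℝ) ≤ γ * M + 1)
    (hmp : 2 ≤ m * p) (x : EuclideanSpace ℝ (Fin d)) :
    medoidNoiseMoment R am D f x ≤
      ENNReal.ofReal (3 / (1 - 2 * γ) * σ * ((M.choose m * R ^ M : ℕ) : ℝ)) ^ 2 := by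
  have hm' : (0 : ℝ) < m := by positivity
  have hCpos : 0 < 3 / (1 - 2 * γ) := div_pos three_pos (by linarith)
  have hmeas : ∀ i : Fin M × Fin R, Measurable fun b : Fin M × Fin R → Ξ =>
      ‖noise D f x (b i)‖ₑ ^ (2 / (m : ℝ)) := fun i =>
    (((hf.measurable_noise x).comp (measurable_pi_apply i)).enorm).pow_const _
  have hprod : ∀ A ∈ Finset.powersetCard m (Finset.univ : Finset (Fin M)),
      ∀ κ : Fin M → Fin R,
      ∫⁻ b, ∏ j ∈ A, ‖noise D f x (b (j, κ j))‖ₑ ^ (2 / (m : ℝ))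
        ∂(Measure.pi fun _ : Fin M × Fin R => D) ≤ ENNReal.ofReal σ ^ 2 := by
    intro A hA κ
    -- The map `j ↦ (j, κ j)` is injective, so the selected samples are distinct and independent.
    have hind : iIndepFun (fun (j : Fin M) (b : Fin M × Fin R → Ξ) =>
        ‖noise D f x (b (j, κ j))‖ₑ ^ (2 / (m : ℝ))) (Measure.pi fun _ : Fin M × Fin R => D) :=
      (iIndepFun_pi (μ := fun _ : Fin M × Fin R => D)
        (X := fun _ s => ‖noise D f x s‖ₑ ^ (2 / (m : ℝ)))
        fun _ => ((hf.measurable_noise x).enorm.pow_const _).aemeasurable).precomp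
        (g := fun j => (j, κ j)) fun i j hij => (Prod.ext_iff.1 hij).1
    rw [lintegral_prod_eq_prod_lintegral_of_indepFun A _ hind fun j => hmeas _]
    calc ∏ j ∈ A, ∫⁻ b, ‖noise D f x (b (j, κ j))‖ₑ ^ (2 / (m : ℝ))
          ∂(Measure.pi fun _ : Fin M × Fin R => D)
        ≤ ∏ _j ∈ A, ENNReal.ofReal σ ^ (2 / (m : ℝ)) := by
          refine Finset.prod_le_prod' fun j _ => ?_
          rw [(measurePreserving_eval (fun _ : Fin M × Fin R => D) (j, κ j)).lintegral_comp
            (f := fun s => ‖noise D f x s‖ₑ ^ (2 / (m : ℝ)))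
            ((hf.measurable_noise x).enorm.pow_const _)]
          exact hn.lintegral_rpow_le hf (by positivity) (by
            rw [div_le_iff₀ hm']; linarith) x
      _ = ENNReal.ofReal σ ^ 2 := by
          rw [Finset.prod_const, (Finset.mem_powersetCard.1 hA).2, ← ENNReal.rpow_mul_natCast,
            div_mul_cancel₀ _ hm'.ne', ENNReal.rpow_two]
  set N : ℕ := M.choose m * R ^ M with hN
  have hNpos : 0 < N := Nat.mul_pos (Nat.choose_pos hmM) (pow_pos hR M)
  calc medoidNoiseMoment R am D f x
      ≤ ∫⁻ b, ENNReal.ofReal (3 / (1 - 2 * γ)) ^ 2 *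
          ∑ A ∈ Finset.powersetCard m (Finset.univ : Finset (Fin M)), ∑ κ : Fin M → Fin R,
            ∏ j ∈ A, ‖noise D f x (b (j, κ j))‖ₑ ^ (2 / (m : ℝ))
          ∂(Measure.pi fun _ : Fin M × Fin R => D) := by
        refine lintegral_mono fun b => ?_
        simp only [medoidGrad_sub_gradient hR]
        exact enorm_medoid_sq_le ham hR _ hγ hm hmM hmγ
    _ = ENNReal.ofReal (3 / (1 - 2 * γ)) ^ 2 *
          ∑ A ∈ Finset.powersetCard m (Finset.univ : Finset (Fin M)), ∑ κ : Fin M → Fin R,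
            ∫⁻ b, ∏ j ∈ A, ‖noise D f x (b (j, κ j))‖ₑ ^ (2 / (m : ℝ))
              ∂(Measure.pi fun _ : Fin M × Fin R => D) := by
        have hm1 : ∀ A (κ : Fin M → Fin R), Measurable fun b : Fin M × Fin R → Ξ =>
            ∏ j ∈ A, ‖noise D f x (b (j, κ j))‖ₑ ^ (2 / (m : ℝ)) := fun A κ =>
          Finset.measurable_prod _ fun j _ => hmeas (j, κ j)
        rw [lintegral_const_mul _ (Finset.measurable_sum _ fun A _ =>
          Finset.measurable_sum _ fun κ _ => hm1 A κ),
          lintegral_finsetSum _ fun A _ => Finset.measurable_sum _ fun κ _ => hm1 A κ]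
        congr 1
        exact Finset.sum_congr rfl fun A _ => lintegral_finsetSum _ fun κ _ => hm1 A κ
    _ ≤ ENNReal.ofReal (3 / (1 - 2 * γ)) ^ 2 *
          ∑ _A ∈ Finset.powersetCard m (Finset.univ : Finset (Fin M)), ∑ _κ : Fin M → Fin R,
            ENNReal.ofReal σ ^ 2 := by
        gcongr with A hA κ
        exact hprod A hA κ
    _ = ENNReal.ofReal (3 / (1 - 2 * γ)) ^ 2 * ((N : ℝ≥0∞) * ENNReal.ofReal σ ^ 2) := by
        simp [hN, mul_assoc]
    -- Wasteful, but it makes the whole bound the square of a constant without roots.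
    _ ≤ ENNReal.ofReal (3 / (1 - 2 * γ)) ^ 2 * ((N : ℝ≥0∞) ^ 2 * ENNReal.ofReal σ ^ 2) := by
        gcongr
        exact_mod_cast Nat.le_self_pow two_ne_zero N
    _ = _ := by
        rw [ENNReal.ofReal_mul (by positivity), ENNReal.ofReal_mul hCpos.le, ENNReal.ofReal_natCast]
        ring

/-- The medoid noise is centred, by symmetry. -/
theorem integral_medoidNoise_eq_zero {D : Measure Ξ} [IsProbabilityMeasure D]
    {f : EuclideanSpace ℝ (Fin d) → Ξ → ℝ} {am : (Fin M → ℝ) → Fin M} {p σ : ℝ}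
    (hf : IsLoss D f) (hn : IsNoise D f p σ) (ham : IsArgmin am) (hR : 0 < R)
    (x : EuclideanSpace ℝ (Fin d)) :
    ∫ b, (medoidGrad am f b x - ∇ (popLoss D f) x)
      ∂(Measure.pi fun _ : Fin M × Fin R => D) = 0 := by
  have hν := hf.measurable_noise x
  let h : (Fin M × Fin R → EuclideanSpace ℝ (Fin d)) → EuclideanSpace ℝ (Fin d) :=
    fun v => medoid am (chunkMean v)
  have hh : Measurable h :=
    ham.measurable_medoid.comp (measurable_pi_iff.2 fun j => measurable_chunkMean j)
  have hneg : ∀ v, h (fun i => -v i) = -h v := by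
    intro v
    simp only [h, ← medoid_neg]
    congr 1
    ext1 j
    simp [chunkMean]
  have hmap : ∀ ν : Ξ → EuclideanSpace ℝ (Fin d), Measurable ν →
      ∫ b, h (fun i => ν (b i)) ∂(Measure.pi fun _ : Fin M × Fin R => D) =
        ∫ v, h v ∂(Measure.pi fun _ : Fin M × Fin R => D.map ν) := by
    intro ν hν
    have := Measure.isProbabilityMeasure_map (μ := D) hν.aemeasurable
    rw [← Measure.pi_map_pi (fun _ => hν.aemeasurable), integral_map]
    · exact (measurable_pi_iff.2 fun i => hν.comp (measurable_pi_apply i)).aemeasurable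
    · exact hh.aestronglyMeasurable
  have h1 := hmap _ hν
  -- The integral depends only on the law of the noise, and `h` is odd, so it equals its own
  -- negative. Integrability is not needed, as the Bochner integral is total.
  rw [hn.symmetric x, ← hmap (fun s => -noise D f x s) hν.neg] at h1
  simp only [hneg, integral_neg] at h1
  have h2 : ∫ b, h (fun i => noise D f x (b i)) ∂(Measure.pi fun _ : Fin M × Fin R => D) = 0 := by
    have h3 := add_eq_zero_iff_eq_neg.2 h1
    rw [← two_smul ℝ] at h3
    exact (smul_eq_zero.1 h3).resolve_left two_ne_zero
  simpa only [medoidGrad_sub_gradient hR] using h2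

end RCSGD

/-! ### Clipping and the exponential moment of a single step. -/

namespace RCSGD

variable {d : ℕ}

theorem norm_clip_le_norm {lam : ℝ} (hlam : 0 ≤ lam) (g : EuclideanSpace ℝ (Fin d)) :
    ‖clip lam g‖ ≤ ‖g‖ := by
  rw [clip, norm_smul, Real.norm_of_nonneg (le_min zero_le_one (by positivity))]
  exact mul_le_of_le_one_left (norm_nonneg _) (min_le_left _ _)

theorem norm_clip_le {lam : ℝ} (hlam : 0 ≤ lam) (g : EuclideanSpace ℝ (Fin d)) :
    ‖clip lam g‖ ≤ lam := by
  rcases eq_or_ne g 0 with rfl | hg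
  · simpa [clip] using hlam
  rw [clip, norm_smul, Real.norm_of_nonneg (le_min zero_le_one (by positivity))]
  calc min 1 (lam / ‖g‖) * ‖g‖ ≤ lam / ‖g‖ * ‖g‖ := by gcongr; exact min_le_right _ _
    _ = lam := div_mul_cancel₀ _ (norm_ne_zero_iff.2 hg)

/-- The error made by clipping a perturbation of a vector that is well below the threshold. -/
theorem norm_clip_add_sub_le {lam : ℝ} (hlam : 0 < lam) {G : EuclideanSpace ℝ (Fin d)}
    (hG : ‖G‖ ≤ lam / 2) (n : EuclideanSpace ℝ (Fin d)) :
    ‖clip lam (G + n) - (G + n)‖ ≤ ‖n‖ ^ 2 / (2 * lam) := by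
  set g := G + n with hg
  rcases le_or_gt ‖g‖ lam with h | h
  · have h1 : clip lam g = g := by
      rcases eq_or_ne g 0 with h0 | h0
      · simp [clip, h0]
      · rw [clip, min_eq_left ((one_le_div (norm_pos_iff.2 h0)).2 h), one_smul]
    rw [h1, sub_self, norm_zero]
    positivity
  · have hpos : 0 < ‖g‖ := hlam.trans h
    have h1 : clip lam g - g = (lam / ‖g‖ - 1) • g := by
      rw [clip, min_eq_right ((div_le_one hpos).2 h.le), sub_smul, one_smul]
    rw [h1, norm_smul, Real.norm_eq_abs, abs_sub_comm,
      abs_of_nonneg (sub_nonneg.2 ((div_le_one hpos).2 h.le)), sub_mul,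
      div_mul_cancel₀ _ hpos.ne', one_mul, le_div_iff₀ (by positivity)]
    -- The error is `‖g‖ - lam ≤ ‖n‖ - lam / 2`, and `(‖n‖ - lam)² ≥ 0` does the rest.
    have h2 : ‖g‖ ≤ ‖G‖ + ‖n‖ := norm_add_le _ _
    nlinarith [sq_nonneg (‖n‖ - lam)]

/-- The bound for the decrease of the objective in one step, plus half of the squared gradient. -/
noncomputable def stepExcess (α L : ℝ) (G c : EuclideanSpace ℝ (Fin d)) : ℝ :=
  -α * inner ℝ G c + α / 2 * ‖G‖ ^ 2 + L / 2 * α ^ 2 * ‖c‖ ^ 2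

/-- Clipping keeps the exponent in `[-1, 1]`, where `exp w ≤ 1 + w + w²`. The resulting majorant is
a quadratic polynomial in `n`, so its mean involves only the first two moments of the noise. -/
theorem exp_stepExcess_le {α L lam η : ℝ} (hα : 0 ≤ α) (hL : 0 ≤ L) (hlam : 0 < lam) (hη : 0 ≤ η)
    {G : EuclideanSpace ℝ (Fin d)} (hG : ‖G‖ ≤ lam / 2) (h1 : η * α * lam * ‖G‖ ≤ 1 / 30)
    (h2 : η * L * α ^ 2 * lam ^ 2 ≤ 1 / 100) (n : EuclideanSpace ℝ (Fin d)) :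
    Real.exp (η * stepExcess α L G (clip lam (G + n))) ≤
      1 + η * (-(α / 2) * ‖G‖ ^ 2 - α * inner ℝ G n + α * ‖G‖ * (‖n‖ ^ 2 / (2 * lam))) +
        3 / 4 * (η * α * ‖G‖ ^ 2) ^ 2 +
        (η * L * α ^ 2 * (51 / 100) + 3 * (η * α * ‖G‖) ^ 2) *
          (‖G‖ ^ 2 + 2 * inner ℝ G n + ‖n‖ ^ 2) := by
  set c := clip lam (G + n) with hc
  have hcl : ‖c‖ ≤ lam := norm_clip_le hlam.le _
  have hcg : ‖c‖ ^ 2 ≤ ‖G‖ ^ 2 + 2 * inner ℝ G n + ‖n‖ ^ 2 := by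
    rw [← norm_add_sq_real]
    gcongr
    exact norm_clip_le_norm hlam.le _
  have hin : |inner ℝ G c| ≤ ‖G‖ * ‖c‖ := abs_real_inner_le_norm _ _
  have hbias : -inner ℝ G c ≤ -‖G‖ ^ 2 - inner ℝ G n + ‖G‖ * (‖n‖ ^ 2 / (2 * lam)) := by
    have e1 : inner ℝ G c = inner ℝ G (c - (G + n)) + ‖G‖ ^ 2 + inner ℝ G n := by
      rw [inner_sub_right, inner_add_right, real_inner_self_eq_norm_sq]
      ring
    have e2 := (abs_le.1 (abs_real_inner_le_norm G (c - (G + n)))).1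
    have e3 : ‖G‖ * ‖c - (G + n)‖ ≤ ‖G‖ * (‖n‖ ^ 2 / (2 * lam)) := by
      gcongr
      exact norm_clip_add_sub_le hlam hG n
    linarith
  set x := η * α * inner ℝ G c with hx
  set y := η * (α / 2) * ‖G‖ ^ 2 with hy
  set z := η * (L / 2 * α ^ 2) * ‖c‖ ^ 2 with hz
  have hX : η * stepExcess α L G c = -x + y + z := by
    rw [stepExcess, hx, hy, hz]
    ring
  have hηα : 0 ≤ η * α := by positivity
  have hxle : |x| ≤ η * α * ‖G‖ * ‖c‖ := by
    rw [hx, abs_mul, abs_of_nonneg hηα, mul_assoc (η * α)]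
    gcongr
  have hx1 : |x| ≤ 1 / 30 := by
    refine hxle.trans (le_trans ?_ h1)
    rw [mul_right_comm]
    gcongr
  have hy0 : 0 ≤ y := by positivity
  have hy1 : y ≤ 1 / 120 := by
    have : η * α * (‖G‖ * ‖G‖) ≤ η * α * (lam / 2 * ‖G‖) := by gcongr
    rw [hy]
    linarith
  have hz0 : 0 ≤ z := by positivity
  have hz1 : z ≤ 1 / 200 := by
    have : η * (L / 2 * α ^ 2) * ‖c‖ ^ 2 ≤ η * (L / 2 * α ^ 2) * lam ^ 2 := by gcongr
    rw [hz]
    linarith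
  have hxs : x ^ 2 ≤ (η * α * ‖G‖) ^ 2 * ‖c‖ ^ 2 := by
    rw [← sq_abs, ← mul_pow]
    gcongr
  have habs : |-x + y + z| ≤ 1 := by
    have := abs_le.1 hx1
    rw [abs_le]
    constructor <;> linarith [this.1, this.2]
  have hexp := (abs_le.1 (Real.abs_exp_sub_one_sub_id_le habs)).2
  have hsq : (-x + y + z) ^ 2 ≤ 3 * (x ^ 2 + y ^ 2 + z ^ 2) := by
    linarith [sq_nonneg (x + y), sq_nonneg (x + z), sq_nonneg (y - z)]
  have hzz : z ^ 2 ≤ 1 / 200 * z := by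
    have := mul_le_mul_of_nonneg_left hz1 hz0
    linarith
  have hxb : -x ≤ η * α * (-‖G‖ ^ 2 - inner ℝ G n + ‖G‖ * (‖n‖ ^ 2 / (2 * lam))) := by
    rw [hx, ← mul_neg]
    gcongr
  -- `z + 3 z² ≤ (1 + 3/200) z` by `hzz`, and half of `203/200` is below `51/100`.
  have hfin : z * (203 / 200) + 3 * ((η * α * ‖G‖) ^ 2 * ‖c‖ ^ 2) ≤
      (η * L * α ^ 2 * (51 / 100) + 3 * (η * α * ‖G‖) ^ 2) *
          (‖G‖ ^ 2 + 2 * inner ℝ G n + ‖n‖ ^ 2) := by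
    calc z * (203 / 200) + 3 * ((η * α * ‖G‖) ^ 2 * ‖c‖ ^ 2)
        ≤ (η * L * α ^ 2 * (51 / 100) + 3 * (η * α * ‖G‖) ^ 2) * ‖c‖ ^ 2 := by
          have : 0 ≤ η * L * α ^ 2 * ‖c‖ ^ 2 := by positivity
          rw [hz]
          linarith
      _ ≤ _ := by gcongr
  have hyy : 3 * y ^ 2 = 3 / 4 * (η * α * ‖G‖ ^ 2) ^ 2 := by
    rw [hy]
    ring
  rw [hX]
  calc Real.exp (-x + y + z) ≤ 1 + (-x + y + z) + 3 * (x ^ 2 + y ^ 2 + z ^ 2) := by linarith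
    _ ≤ _ := by
      have : y = η * α / 2 * ‖G‖ ^ 2 := by rw [hy]; ring
      linarith

/-- One step of clipped gradient descent with centred noise of bounded variance. -/
theorem lintegral_exp_stepExcess_le {B : Type*} [MeasurableSpace B] {μ : Measure B}
    [IsProbabilityMeasure μ] {n : B → EuclideanSpace ℝ (Fin d)} (hn : Measurable n)
    (hmean : ∫ b, n b ∂μ = 0) {S : ℝ} (hS : 0 ≤ S)
    (hvar : ∫⁻ b, ‖n b‖ₑ ^ 2 ∂μ ≤ ENNReal.ofReal S ^ 2)
    {α L lam η : ℝ} (hα : 0 ≤ α) (hL : 0 ≤ L) (hlam : 0 < lam) (hη : 0 ≤ η)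
    {G : EuclideanSpace ℝ (Fin d)} (hG : ‖G‖ ≤ lam / 2) (h1 : η * α * lam * ‖G‖ ≤ 1 / 30)
    (h2 : η * L * α ^ 2 * lam ^ 2 ≤ 1 / 100) (h3 : L * α ≤ 1 / 100) :
    ∫⁻ b, ENNReal.ofReal (Real.exp (η * stepExcess α L G (clip lam (G + n b)))) ∂μ ≤
      ENNReal.ofReal (Real.exp (η * (α * S ^ 4 / (4 * lam ^ 2) + L * α ^ 2 * S ^ 2 +
        3 * η * α ^ 2 * ‖G‖ ^ 2 * S ^ 2))) := by
  have hLp : MemLp n 2 μ := by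
    refine ⟨hn.aestronglyMeasurable, ?_⟩
    rw [eLpNorm_lt_top_iff_lintegral_rpow_enorm_lt_top two_ne_zero ENNReal.ofNat_ne_top]
    simp only [ENNReal.toReal_ofNat, ENNReal.rpow_two]
    exact hvar.trans_lt (by simp)
  have hint : Integrable n μ := hLp.integrable one_le_two
  have hintsq : Integrable (fun b => ‖n b‖ ^ 2) μ := hLp.integrable_norm_pow two_ne_zero
  have hinner : Integrable (fun b => inner ℝ G (n b)) μ := hint.const_inner G
  have hinner0 : ∫ b, inner ℝ G (n b) ∂μ = 0 := by
    rw [integral_inner hint, hmean, inner_zero_right]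
  have hsq : ∫ b, ‖n b‖ ^ 2 ∂μ ≤ S ^ 2 := by
    rw [integral_eq_lintegral_of_nonneg_ae (Eventually.of_forall fun b => by positivity)
      hintsq.aestronglyMeasurable]
    refine ENNReal.toReal_le_of_le_ofReal (by positivity) ?_
    rw [ENNReal.ofReal_pow hS]
    refine le_trans (le_of_eq ?_) hvar
    refine lintegral_congr fun b => ?_
    rw [ENNReal.ofReal_pow (norm_nonneg _), ofReal_norm]
  set K := η * L * α ^ 2 * (51 / 100) + 3 * (η * α * ‖G‖) ^ 2 with hK
  have hK0 : 0 ≤ K := by positivity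
  set p₀ := 1 - η * (α / 2) * ‖G‖ ^ 2 + 3 / 4 * (η * α * ‖G‖ ^ 2) ^ 2 + K * ‖G‖ ^ 2 with hp₀
  set q := 2 * K - η * α with hq
  set r := η * (α * ‖G‖ / (2 * lam)) + K with hr
  have hr0 : 0 ≤ r := by positivity
  have hpt : ∀ b, Real.exp (η * stepExcess α L G (clip lam (G + n b))) ≤
      p₀ + q * inner ℝ G (n b) + r * ‖n b‖ ^ 2 := by
    intro b
    refine (exp_stepExcess_le hα hL hlam hη hG h1 h2 (n b)).trans (le_of_eq ?_)
    rw [hp₀, hq, hr, ← hK]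
    ring
  have hi : Integrable (fun b => p₀ + q * inner ℝ G (n b) + r * ‖n b‖ ^ 2) μ :=
    ((integrable_const p₀).add (hinner.const_mul q)).add (hintsq.const_mul r)
  have hival : ∫ b, (p₀ + q * inner ℝ G (n b) + r * ‖n b‖ ^ 2) ∂μ ≤ p₀ + r * S ^ 2 := by
    have hi' : Integrable (fun b => p₀ + q * inner ℝ G (n b)) μ :=
      (integrable_const p₀).add (hinner.const_mul q)
    rw [integral_add hi' (hintsq.const_mul r),
      integral_add (integrable_const p₀) (hinner.const_mul q), integral_const_mul,
      integral_const_mul, hinner0]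
    simp only [integral_const, probReal_univ, one_smul, mul_zero, add_zero]
    gcongr
  calc ∫⁻ b, ENNReal.ofReal (Real.exp (η * stepExcess α L G (clip lam (G + n b)))) ∂μ
      ≤ ∫⁻ b, ENNReal.ofReal (p₀ + q * inner ℝ G (n b) + r * ‖n b‖ ^ 2) ∂μ :=
        lintegral_mono fun b => ENNReal.ofReal_le_ofReal (hpt b)
    _ = ENNReal.ofReal (∫ b, (p₀ + q * inner ℝ G (n b) + r * ‖n b‖ ^ 2) ∂μ) :=
        (ofReal_integral_eq_lintegral_ofReal hi
          (Eventually.of_forall fun b => (Real.exp_pos _).le.trans (hpt b))).symm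
    _ ≤ _ := by
        -- By `1 + w ≤ exp w` it suffices to compare exponents. The term `-(α / 2) ‖G‖²` absorbs
        -- every other multiple of `‖G‖²` except the one carrying `S²`.
        refine ENNReal.ofReal_le_ofReal (hival.trans (le_trans ?_ (Real.add_one_le_exp _)))
        set a := ‖G‖ with ha
        have ha0 : 0 ≤ a := norm_nonneg _
        have hu : η * α * a ^ 2 ≤ 1 / 60 := by
          have : η * α * (a * a) ≤ η * α * (lam / 2 * a) := by gcongr
          nlinarith
        have hu0 : 0 ≤ η * α * a ^ 2 := by positivity
        have e1 : (η * α * a ^ 2) ^ 2 ≤ 1 / 60 * (η * α * a ^ 2) := by nlinarith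
        have e2 : η * L * α ^ 2 * a ^ 2 ≤ 1 / 100 * (η * α * a ^ 2) := by
          have := mul_le_mul_of_nonneg_right h3 hu0
          linarith
        -- The clipping bias is split by Young's inequality, using up half of the available descent.
        have e3 : α * a / (2 * lam) * S ^ 2 ≤ α / 4 * a ^ 2 + α * S ^ 4 / (4 * lam ^ 2) := by
          have : α / 4 * a ^ 2 + α * S ^ 4 / (4 * lam ^ 2) - α * a / (2 * lam) * S ^ 2 =
              α / 4 * (a - S ^ 2 / lam) ^ 2 := by
            field_simp
            ring
          have : 0 ≤ α / 4 * (a - S ^ 2 / lam) ^ 2 := by positivity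
          linarith
        have e4 := mul_le_mul_of_nonneg_left e3 hη
        have e5 : 0 ≤ η * L * α ^ 2 * S ^ 2 := by positivity
        have e6 : K * a ^ 2 = 51 / 100 * (η * L * α ^ 2 * a ^ 2) + 3 * (η * α * a ^ 2) ^ 2 := by
          rw [hK]; ring
        have e7 : r * S ^ 2 = η * (α * a / (2 * lam) * S ^ 2) + 51 / 100 * (η * L * α ^ 2 * S ^ 2)
            + η * (3 * η * α ^ 2 * a ^ 2 * S ^ 2) := by
          rw [hr, hK]; ring
        rw [e7, hp₀, e6]
        linarith

end RCSGD

/-! ### Recursions driven by fresh data. -/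

namespace RCSGD

section Recursion

variable {Ω Ξ I Z : Type*} [MeasurableSpace Ξ] [MeasurableSpace Z] [Fintype I]
  {data : ℕ → I → Ω → Ξ} {z : ℕ → Ω → Z} {z₀ : Z}
  {Φ : Z × (I → Ξ) → Z}

/-- The states of a recursion are measurable functions of the data used so far. -/
theorem exists_measurable_of_recursion (hΦ : Measurable Φ) (h0 : ∀ ω, z 0 ω = z₀)
    (hz : ∀ t ω, z (t + 1) ω = Φ (z t ω, fun i => data t i ω)) (t : ℕ) :
    ∃ h : ((Finset.range t ×ˢ (Finset.univ : Finset I) : Finset (ℕ × I)) → Ξ) → Z,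
      Measurable h ∧ ∀ ω, z t ω = h (fun i => data i.1.1 i.1.2 ω) := by
  induction t with
  | zero => exact ⟨fun _ => z₀, measurable_const, fun ω => h0 ω⟩
  | succ t ih =>
    obtain ⟨h, hm, hh⟩ := ih
    have hsub : ∀ i : (Finset.range t ×ˢ (Finset.univ : Finset I) : Finset (ℕ × I)),
        i.1 ∈ Finset.range (t + 1) ×ˢ (Finset.univ : Finset I) := fun i => by
      have := i.2
      simp only [Finset.mem_product, Finset.mem_range, Finset.mem_univ, and_true] at this ⊢
      omega
    have hlast : ∀ i : I, (t, i) ∈ Finset.range (t + 1) ×ˢ (Finset.univ : Finset I) := fun i => by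
      simp
    refine ⟨fun v => Φ (h (fun i => v ⟨i.1, hsub i⟩), fun i => v ⟨(t, i), hlast i⟩), ?_, ?_⟩
    · refine hΦ.comp ((hm.comp ?_).prodMk ?_)
      · exact measurable_pi_iff.2 fun i => measurable_pi_apply _
      · exact measurable_pi_iff.2 fun i => measurable_pi_apply _
    · intro ω
      rw [hz, hh]

/-- The state at time `t` uses only batches before `t`, hence is independent of batch `t`. The
product law replaces conditional expectations by Fubini. -/
theorem map_prodMk_of_recursion [MeasurableSpace Ω] {P : Measure Ω} [IsProbabilityMeasure P]
    {D : Measure Ξ}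
    (hdata : ∀ t i, Measurable (data t i)) (hlaw : ∀ t i, P.map (data t i) = D)
    (hind : iIndepFun (fun n : ℕ × I => data n.1 n.2) P)
    (hΦ : Measurable Φ) (h0 : ∀ ω, z 0 ω = z₀)
    (hz : ∀ t ω, z (t + 1) ω = Φ (z t ω, fun i => data t i ω)) (t : ℕ) :
    Measurable (z t) ∧ P.map (fun ω => (z t ω, fun i => data t i ω)) =
      (P.map (z t)).prod (Measure.pi fun _ : I => D) := by
  obtain ⟨h, hm, hh⟩ := exists_measurable_of_recursion hΦ h0 hz t
  have hbm : Measurable fun ω i => data t i ω := measurable_pi_iff.2 fun i => hdata t i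
  have hzm : Measurable (z t) := by
    rw [show z t = _ from funext hh]
    exact hm.comp (measurable_pi_iff.2 fun i => hdata _ _)
  refine ⟨hzm, ?_⟩
  have hbl : P.map (fun ω i => data t i ω) = Measure.pi fun _ : I => D := by
    have h1 : iIndepFun (fun i => data t i) P :=
      hind.precomp (g := fun i => (t, i)) fun i j hij => (Prod.ext_iff.1 hij).2
    rw [h1.map_fun_eq_pi_map fun i => (hdata t i).aemeasurable]
    simp only [hlaw]
  have hdisj : Disjoint (Finset.range t ×ˢ (Finset.univ : Finset I))
      ({t} ×ˢ (Finset.univ : Finset I)) := by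
    rw [Finset.disjoint_left]
    rintro ⟨s, i⟩ h1 h2
    simp at h1 h2
    omega
  have h2 := hind.indepFun_finset _ _ hdisj fun n => hdata n.1 n.2
  have hmem : ∀ i : I, (t, i) ∈ ({t} ×ˢ (Finset.univ : Finset I) : Finset (ℕ × I)) := fun i => by
    simp
  have h3 : IndepFun (z t) (fun ω i => data t i ω) P := by
    rw [show z t = _ from funext hh]
    exact h2.comp hm (ψ := fun v i => v ⟨(t, i), hmem i⟩)
      (measurable_pi_iff.2 fun i => measurable_pi_apply _)
  rw [(indepFun_iff_map_prod_eq_prod_map_map hzm.aemeasurable hbm.aemeasurable).1 h3, hbl]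

/-- A potential that grows at most by a factor in mean in each step of a recursion with fresh
data. -/
theorem lintegral_potential_le [MeasurableSpace Ω] {P : Measure Ω} [IsProbabilityMeasure P]
    {D : Measure Ξ} [IsProbabilityMeasure D]
    (hdata : ∀ t i, Measurable (data t i)) (hlaw : ∀ t i, P.map (data t i) = D)
    (hind : iIndepFun (fun n : ℕ × I => data n.1 n.2) P)
    (hΦ : Measurable Φ) (h0 : ∀ ω, z 0 ω = z₀)
    (hz : ∀ t ω, z (t + 1) ω = Φ (z t ω, fun i => data t i ω))
    {W : Z → ℝ≥0∞} (hW : Measurable W) {K : ℝ≥0∞}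
    (hstep : ∀ y, ∫⁻ b, W (Φ (y, b)) ∂(Measure.pi fun _ : I => D) ≤ K * W y) (t : ℕ) :
    ∫⁻ ω, W (z t ω) ∂P ≤ K ^ t * W z₀ := by
  induction t with
  | zero => simp [h0]
  | succ t ih =>
    obtain ⟨hzm, hmap⟩ := map_prodMk_of_recursion hdata hlaw hind hΦ h0 hz t
    have hbm : Measurable fun ω i => data t i ω := measurable_pi_iff.2 fun i => hdata t i
    calc ∫⁻ ω, W (z (t + 1) ω) ∂P
        = ∫⁻ q, W (Φ q) ∂(P.map fun ω => (z t ω, fun i => data t i ω)) := by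
          simp only [hz]
          exact (lintegral_map (hW.comp hΦ) (hzm.prodMk hbm)).symm
      _ = ∫⁻ y, ∫⁻ b, W (Φ (y, b)) ∂(Measure.pi fun _ : I => D) ∂(P.map (z t)) := by
          rw [hmap]
          exact lintegral_prod _ (hW.comp hΦ).aemeasurable
      _ ≤ ∫⁻ y, K * W y ∂(P.map (z t)) := lintegral_mono hstep
      _ = K * ∫⁻ ω, W (z t ω) ∂P := by
          rw [lintegral_const_mul _ hW, lintegral_map hW hzm]
      _ ≤ K ^ (t + 1) * W z₀ := by
          rw [pow_succ', mul_assoc]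
          gcongr

end Recursion

/-! ### The stopped run and the tail bound. -/

variable {d M R : ℕ} {Ξ Ω : Type*}

/-- One step of the algorithm, stopped as soon as the objective exceeds the level `c`. The second
component accumulates the squared gradient norms. -/
noncomputable def stoppedStep (am : (Fin M → ℝ) → Fin M) (f : EuclideanSpace ℝ (Fin d) → Ξ → ℝ)
    (F : EuclideanSpace ℝ (Fin d) → ℝ) (α lam c : ℝ)
    (q : (EuclideanSpace ℝ (Fin d) × ℝ) × (Fin M × Fin R → Ξ)) : EuclideanSpace ℝ (Fin d) × ℝ :=
  open Classical in
  if F q.1.1 ≤ c then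
    (q.1.1 - α • clip lam (medoidGrad am f q.2 q.1.1), q.1.2 + α / 2 * ‖∇ F q.1.1‖ ^ 2)
  else q.1

/-- The stopped run of the algorithm. -/
noncomputable def stoppedRun (am : (Fin M → ℝ) → Fin M) (f : EuclideanSpace ℝ (Fin d) → Ξ → ℝ)
    (F : EuclideanSpace ℝ (Fin d) → ℝ) (α lam c : ℝ) (x₀ : EuclideanSpace ℝ (Fin d))
    (data : ℕ → Fin M × Fin R → Ω → Ξ) : ℕ → Ω → EuclideanSpace ℝ (Fin d) × ℝ
  | 0, _ => (x₀, 0)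
  | t + 1, ω =>
    stoppedStep am f F α lam c (stoppedRun am f F α lam c x₀ data t ω, fun i => data t i ω)

theorem stoppedRun_snd_nonneg {am : (Fin M → ℝ) → Fin M} {f : EuclideanSpace ℝ (Fin d) → Ξ → ℝ}
    {F : EuclideanSpace ℝ (Fin d) → ℝ} {α lam c : ℝ} (hα : 0 ≤ α) {x₀ : EuclideanSpace ℝ (Fin d)}
    {data : ℕ → Fin M × Fin R → Ω → Ξ} (t : ℕ) (ω : Ω) :
    0 ≤ (stoppedRun am f F α lam c x₀ data t ω).2 := by
  induction t with
  | zero => exact le_rfl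
  | succ t ih =>
    rw [stoppedRun, stoppedStep]
    split_ifs
    · dsimp only
      positivity
    · exact ih

/-- As long as the objective does not exceed the level, the stopped run is the original one. -/
theorem stoppedRun_eq {am : (Fin M → ℝ) → Fin M} {f : EuclideanSpace ℝ (Fin d) → Ξ → ℝ}
    {F : EuclideanSpace ℝ (Fin d) → ℝ} {α lam c : ℝ} {x₀ : EuclideanSpace ℝ (Fin d)}
    {data : ℕ → Fin M × Fin R → Ω → Ξ} (t : ℕ) (ω : Ω)
    (h : F (stoppedRun am f F α lam c x₀ data t ω).1 ≤ c) :
    stoppedRun am f F α lam c x₀ data t ω = (iterate am f α lam x₀ data t ω,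
      α / 2 * ∑ s ∈ Finset.range t, ‖∇ F (iterate am f α lam x₀ data s ω)‖ ^ 2) := by
  induction t with
  | zero => simp [stoppedRun, iterate]
  | succ t ih =>
    rw [stoppedRun, stoppedStep] at h ⊢
    split_ifs at h ⊢ with h1
    · dsimp only at h1 ⊢
      rw [ih h1, Finset.sum_range_succ, mul_add]
      rfl
    -- A frozen run stays above the level, so being below it at time `t` excludes any earlier stop.
    · exact absurd h h1

theorem measurable_stoppedStep [MeasurableSpace Ξ] {D : Measure Ξ}
    {f : EuclideanSpace ℝ (Fin d) → Ξ → ℝ}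
    {am : (Fin M → ℝ) → Fin M} (hf : IsLoss D f) (ham : IsArgmin am)
    {F : EuclideanSpace ℝ (Fin d) → ℝ} {L : ℝ} (hF : IsSmooth F L) (α lam c : ℝ) :
    Measurable (stoppedStep am f F α lam c :
      (EuclideanSpace ℝ (Fin d) × ℝ) × (Fin M × Fin R → Ξ) → EuclideanSpace ℝ (Fin d) × ℝ) := by
  classical
  have hx : Measurable fun q : (EuclideanSpace ℝ (Fin d) × ℝ) × (Fin M × Fin R → Ξ) => q.1.1 :=
    measurable_fst.comp measurable_fst
  refine Measurable.ite (measurableSet_le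
    (hF.differentiable.continuous.measurable.comp hx) measurable_const)
    (Measurable.prodMk ?_ ?_) measurable_fst
  · exact hx.sub (((measurable_clip lam).comp
      ((measurable_medoidGrad hf ham).comp (hx.prodMk measurable_snd))).const_smul α)
  · exact (measurable_snd.comp measurable_fst).add
      (((hF.continuous_gradient.measurable.comp hx).norm.pow_const 2).const_mul _)

/-- High-probability bound for the squared gradients along the run, for parameters that satisfy
the inequalities that the analysis needs. -/
theorem measure_sum_gradient_sq_gt_le [MeasurableSpace Ξ] [MeasurableSpace Ω] {P : Measure Ω}
    [IsProbabilityMeasure P]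
    {D : Measure Ξ} [IsProbabilityMeasure D] {f : EuclideanSpace ℝ (Fin d) → Ξ → ℝ}
    {am : (Fin M → ℝ) → Fin M} {x₀ : EuclideanSpace ℝ (Fin d)}
    {data : ℕ → Fin M × Fin R → Ω → Ξ} {p σ S L Fmin Δ α lam η : ℝ} (hR : 0 < R)
    (hf : IsLoss D f) (hn : IsNoise D f p σ) (ham : IsArgmin am) (hF : IsSmooth (popLoss D f) L)
    (hL : 0 < L) (hS : 0 ≤ S) (hvar : ∀ x, medoidNoiseMoment R am D f x ≤ ENNReal.ofReal S ^ 2)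
    (hmin : ∀ x, Fmin ≤ popLoss D f x) (hΔ : popLoss D f x₀ - Fmin = Δ)
    (hdata : ∀ t i, Measurable (data t i)) (hlaw : ∀ t i, P.map (data t i) = D)
    (hind : iIndepFun (fun n : ℕ × (Fin M × Fin R) => data n.1 n.2) P)
    (hα : 0 ≤ α) (hlam : 0 < lam) (hη : 0 < η) (T : ℕ)
    (h0 : √(90 * L * Δ) ≤ lam / 2) (h1 : η * α * lam * √(90 * L * Δ) ≤ 1 / 30)
    (h2 : η * L * α ^ 2 * lam ^ 2 ≤ 1 / 100) (h3 : L * α ≤ 1 / 100)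
    (h4 : T * (α * S ^ 4 / (4 * lam ^ 2) + L * α ^ 2 * S ^ 2 +
      3 * η * α ^ 2 * (90 * L * Δ) * S ^ 2) ≤ 4 * Δ) :
    P {ω | 45 * Δ < α / 2 * ∑ t ∈ Finset.range T,
      ‖∇ (popLoss D f) (iterate am f α lam x₀ data t ω)‖ ^ 2} ≤
        ENNReal.ofReal (Real.exp (-(40 * η * Δ))) := by
  set F := popLoss D f with hFdef
  have hΔ0 : 0 ≤ Δ := by rw [← hΔ]; exact sub_nonneg.2 (hmin x₀)
  set c := Fmin + 45 * Δ with hc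
  set ε := α * S ^ 4 / (4 * lam ^ 2) + L * α ^ 2 * S ^ 2 +
      3 * η * α ^ 2 * (90 * L * Δ) * S ^ 2 with hε
  have hε0 : 0 ≤ ε := by positivity
  let W : EuclideanSpace ℝ (Fin d) × ℝ → ℝ≥0∞ := fun q =>
    ENNReal.ofReal (Real.exp (η * (F q.1 - Fmin + q.2)))
  have hFm : Measurable F := hF.differentiable.continuous.measurable
  have hW : Measurable W := by
    refine ENNReal.measurable_ofReal.comp (Real.measurable_exp.comp (Measurable.const_mul ?_ η))
    exact ((hFm.comp measurable_fst).sub_const _).add measurable_snd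
  have hΦ := measurable_stoppedStep (R := R) hf ham hF α lam c
  have hstep : ∀ y, ∫⁻ b, W (stoppedStep am f F α lam c (y, b))
      ∂(Measure.pi fun _ : Fin M × Fin R => D) ≤ ENNReal.ofReal (Real.exp (η * ε)) * W y := by
    rintro ⟨y, a⟩
    by_cases hy : F y ≤ c
    · set G := ∇ F y with hG
      let n : (Fin M × Fin R → Ξ) → EuclideanSpace ℝ (Fin d) := fun b => medoidGrad am f b y - G
      -- The constant is `90 = 2 * 45`, from `‖∇F‖² ≤ 2L(F - Fmin)` below the level `c`.
      have hGn : ‖G‖ ≤ √(90 * L * Δ) := by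
        refine Real.le_sqrt_of_sq_le ?_
        have h5 := norm_gradient_sq_le hF.differentiable hL hF.lipschitz hmin y
        have h6 : F y - Fmin ≤ 45 * Δ := by linarith
        have h7 := mul_le_mul_of_nonneg_left h6 (by positivity : 0 ≤ 2 * L)
        linarith
      have hnm : Measurable n :=
        ((measurable_medoidGrad hf ham).comp measurable_prodMk_left).sub_const G
      have hcore := lintegral_exp_stepExcess_le hnm (integral_medoidNoise_eq_zero hf hn ham hR y)
        hS (hvar y) hα hL.le hlam hη.le (hGn.trans h0)
        (le_trans (by gcongr) h1) h2 h3
      have hG2 : ‖G‖ ^ 2 ≤ 90 * L * Δ := by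
        have := pow_le_pow_left₀ (norm_nonneg G) hGn 2
        rwa [Real.sq_sqrt (by positivity)] at this
      calc ∫⁻ b, W (stoppedStep am f F α lam c ((y, a), b))
            ∂(Measure.pi fun _ : Fin M × Fin R => D)
          ≤ ∫⁻ b, ENNReal.ofReal (Real.exp (η * stepExcess α L G (clip lam (G + n b)))) *
              W (y, a) ∂(Measure.pi fun _ : Fin M × Fin R => D) := by
            refine lintegral_mono fun b => ?_
            simp only [W]
            rw [← ENNReal.ofReal_mul (Real.exp_pos _).le, ← Real.exp_add]
            refine ENNReal.ofReal_le_ofReal (Real.exp_le_exp.2 ?_)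
            rw [← mul_add]
            refine mul_le_mul_of_nonneg_left ?_ hη.le
            have e : G + n b = medoidGrad am f b y := add_sub_cancel _ _
            rw [stoppedStep, if_pos hy, e]
            set g := clip lam (medoidGrad am f b y)
            have hdesc := le_add_inner_add_of_lipschitz_gradient hF.differentiable hF.lipschitz
              y (-(α • g))
            rw [← sub_eq_add_neg, inner_neg_right, inner_smul_right, norm_neg, norm_smul,
              Real.norm_of_nonneg hα, ← hG] at hdesc
            simp only [stepExcess]
            linarith
        _ = (∫⁻ b, ENNReal.ofReal (Real.exp (η * stepExcess α L G (clip lam (G + n b))))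
              ∂(Measure.pi fun _ : Fin M × Fin R => D)) * W (y, a) := by
            refine lintegral_mul_const' _ _ ENNReal.ofReal_ne_top
        _ ≤ _ := by
            gcongr
            refine hcore.trans (ENNReal.ofReal_le_ofReal (Real.exp_le_exp.2 ?_))
            rw [hε]
            gcongr
    · have : ∀ b : Fin M × Fin R → Ξ, stoppedStep am f F α lam c ((y, a), b) = (y, a) := fun b => by
        rw [stoppedStep, if_neg hy]
      simp only [this, lintegral_const, measure_univ, mul_one]
      refine le_mul_of_one_le_left zero_le ?_
      rw [← ENNReal.ofReal_one]
      exact ENNReal.ofReal_le_ofReal (Real.one_le_exp (by positivity))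
  have hpot := lintegral_potential_le (z := stoppedRun am f F α lam c x₀ data) hdata hlaw hind hΦ
    (fun _ => rfl) (fun _ _ => rfl) hW hstep T
  -- Both summands of the exponent are nonnegative. If their sum is below `45Δ`, then `F ≤ c`, so
  -- the run was never stopped, and the accumulated gradient sum is below `45Δ` as well.
  have hsub : {ω | 45 * Δ < α / 2 * ∑ t ∈ Finset.range T,
      ‖∇ F (iterate am f α lam x₀ data t ω)‖ ^ 2} ⊆
      {ω | ENNReal.ofReal (Real.exp (η * (45 * Δ))) ≤
        W (stoppedRun am f F α lam c x₀ data T ω)} := by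
    intro ω hω
    by_contra hcon
    simp only [Set.mem_ofPred_eq, not_le, W] at hcon hω
    rw [ENNReal.ofReal_lt_ofReal_iff (Real.exp_pos _), Real.exp_lt_exp,
      mul_lt_mul_iff_right₀ hη] at hcon
    have ha := stoppedRun_snd_nonneg (am := am) (f := f) (F := F) (lam := lam) (c := c)
      (x₀ := x₀) (data := data) hα T ω
    have heq := stoppedRun_eq (am := am) (f := f) (F := F) (α := α) (lam := lam) (c := c)
      (x₀ := x₀) (data := data) T ω (by linarith)
    rw [heq] at hcon
    have := hmin (iterate am f α lam x₀ data T ω)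
    dsimp only at hcon
    linarith
  calc P _ ≤ P {ω | ENNReal.ofReal (Real.exp (η * (45 * Δ))) ≤
        W (stoppedRun am f F α lam c x₀ data T ω)} := measure_mono hsub
    _ ≤ (∫⁻ ω, W (stoppedRun am f F α lam c x₀ data T ω) ∂P) /
          ENNReal.ofReal (Real.exp (η * (45 * Δ))) := by
        refine meas_ge_le_lintegral_div ?_ (by simp [Real.exp_pos]) ENNReal.ofReal_ne_top
        exact (hW.comp (map_prodMk_of_recursion hdata hlaw hind hΦ
          (z := stoppedRun am f F α lam c x₀ data) (fun _ => rfl) (fun _ _ => rfl) T).1).aemeasurable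
    _ ≤ ENNReal.ofReal (Real.exp (η * ε)) ^ T * W (x₀, 0) /
          ENNReal.ofReal (Real.exp (η * (45 * Δ))) := by gcongr
    _ = ENNReal.ofReal (Real.exp (T * (η * ε) + η * Δ - η * (45 * Δ))) := by
        simp only [W, hΔ, add_zero]
        rw [← ENNReal.ofReal_pow (Real.exp_pos _).le, ← ENNReal.ofReal_mul (by positivity),
          ← ENNReal.ofReal_div_of_pos (Real.exp_pos _), Real.exp_sub, Real.exp_add,
          Real.exp_nat_mul]
    _ ≤ _ := by
        -- Drift `4Δ` plus initial value `Δ` minus level `45Δ` leaves `-40Δ`.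
        refine ENNReal.ofReal_le_ofReal (Real.exp_le_exp.2 ?_)
        have := mul_le_mul_of_nonneg_left h4 hη.le
        linarith

end RCSGD

/-! ### Choice of parameters and the rate. -/

namespace RCSGD

theorem one_le_tau (δ : ℝ) : 1 ≤ tau δ := le_max_right _ _

theorem exp_neg_tau_le {δ : ℝ} (hδ : 0 < δ) : Real.exp (-tau δ) ≤ δ := by
  rw [Real.exp_neg, inv_le_comm₀ (Real.exp_pos _) hδ]
  calc δ⁻¹ = Real.exp (Real.log (1 / δ)) := by rw [Real.exp_log (by positivity), one_div]
    _ ≤ Real.exp (tau δ) := Real.exp_le_exp.2 (le_max_left _ _)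

theorem threshold_two (L Δ S δ : ℝ) (T : ℕ) :
    threshold 2 L Δ S δ T = max (max (8 * tau δ / √(L * Δ) * (T : ℝ) ^ (1 / 4 : ℝ) * S ^ 2)
      (2 * √(90 * L * Δ))) (√32 * S * (T : ℝ) ^ (1 / 4 : ℝ)) := by
  rw [threshold, Real.sqrt_eq_rpow 32]
  norm_num

theorem stepSize_two (L Δ S δ : ℝ) (T : ℕ) :
    stepSize 2 L Δ S δ T =
      √Δ / ((T : ℝ) ^ (1 / 4 : ℝ) * (8 * threshold 2 L Δ S δ T * √L * tau δ)) := by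
  have : (T : ℝ) ^ ((1 - 2) / (3 * 2 - 2) : ℝ) = ((T : ℝ) ^ (1 / 4 : ℝ))⁻¹ := by
    rw [← Real.rpow_neg (Nat.cast_nonneg T)]
    norm_num
  rw [stepSize, this]
  ring

/-- Each entry of the maximum is the matching entry of the threshold divided by `T^(3/4)`. In this
form the rate can be compared with `90Δ / (αT)`. -/
theorem rateBound_two (L Δ S δ : ℝ) {T : ℕ} (hT : 1 ≤ T) :
    rateBound 2 L Δ S δ T = 720 * √(Δ * L) * tau δ *
      (threshold 2 L Δ S δ T / ((T : ℝ) ^ (1 / 4 : ℝ)) ^ 3) := by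
  have hT' : (0 : ℝ) < T := by positivity
  set u := (T : ℝ) ^ (1 / 4 : ℝ) with hu
  have hu0 : 0 < u := Real.rpow_pos_of_pos hT' _
  have e1 : (T : ℝ) ^ ((2 - 2 * 2) / (3 * 2 - 2) : ℝ) = u / u ^ 3 := by
    rw [hu, ← Real.rpow_mul_natCast hT'.le, ← Real.rpow_sub hT']
    norm_num
  have e2 : (T : ℝ) ^ ((1 - 2 * 2) / (3 * 2 - 2) : ℝ) = 1 / u ^ 3 := by
    rw [hu, ← Real.rpow_mul_natCast hT'.le, one_div, ← Real.rpow_neg hT'.le]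
    norm_num
  rw [rateBound, threshold_two, e1, e2, ← max_div_div_right (by positivity),
    ← max_div_div_right (by positivity), Real.sqrt_eq_rpow 32, ← hu]
  congr 1
  norm_num
  ring_nf

theorem rateBound_two_isBigO (L Δ S δ : ℝ) :
    (fun T : ℕ => rateBound 2 L Δ S δ T) =O[atTop]
      (fun T : ℕ => (T : ℝ) ^ (-(1 / 2) : ℝ)) := by
  refine IsBigO.of_bound (|720 * √(Δ * L) * tau δ| * (|8 * tau δ / √(L * Δ) * S ^ 2| +
    |2 * √(90 * L * Δ)| + |√32 * S|)) ?_
  filter_upwards [eventually_ge_atTop 1] with T hT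
  have hT' : (0 : ℝ) < T := by positivity
  rw [rateBound_two L Δ S δ hT, threshold_two, norm_mul, Real.norm_eq_abs,
    mul_assoc |720 * √(Δ * L) * tau δ|]
  refine mul_le_mul_of_nonneg_left ?_ (abs_nonneg _)
  set u := (T : ℝ) ^ (1 / 4 : ℝ) with hu
  have hu1 : 1 ≤ u := Real.one_le_rpow (by exact_mod_cast hT) (by norm_num)
  have hu0 : 0 < u := by linarith
  have e1 : (T : ℝ) ^ (-(1 / 2) : ℝ) = u / u ^ 3 := by
    rw [hu, ← Real.rpow_mul_natCast hT'.le, ← Real.rpow_sub hT']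
    norm_num
  rw [e1, Real.norm_of_nonneg (by positivity : 0 ≤ u / u ^ 3), norm_div,
    Real.norm_of_nonneg (by positivity : 0 ≤ u ^ 3), ← mul_div_assoc]
  gcongr
  set a := 8 * tau δ / √(L * Δ)
  have h1 : |a * u * S ^ 2| = |a * S ^ 2| * u := by
    rw [mul_right_comm, abs_mul, abs_of_pos hu0]
  have h2 : |2 * √(90 * L * Δ)| ≤ |2 * √(90 * L * Δ)| * u :=
    le_mul_of_one_le_right (abs_nonneg _) hu1
  have h3 : |√32 * S * u| = |√32 * S| * u := by rw [abs_mul, abs_of_pos hu0]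
  have n1 : 0 ≤ |a * S ^ 2| * u := by positivity
  have n2 : 0 ≤ |2 * √(90 * L * Δ)| * u := by positivity
  have n3 : 0 ≤ |√32 * S| * u := by positivity
  rw [Real.norm_eq_abs, add_mul, add_mul]
  refine abs_max_le_max_abs_abs.trans (max_le (abs_max_le_max_abs_abs.trans (max_le ?_ ?_)) ?_) <;>
    linarith

/-- The choice of threshold and step size satisfies the inequalities of the analysis. -/
theorem parameter_bounds {s e τ S u lam α η : ℝ} (hs : 0 < s) (he : 0 < e) (hτ : 1 ≤ τ)
    (hS : 0 < S) (hu : 1 ≤ u) (hlam : 0 < lam) (hA : 8 * τ * u * S ^ 2 ≤ lam * (s * e))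
    (hB : 18 * (s * e) ≤ lam) (hC : 32 * (S * u) ^ 2 ≤ lam ^ 2)
    (hα : α = e / (u * (8 * lam * s * τ))) (hη : η = τ / (40 * e ^ 2)) :
    η * α * lam * (19 / 2 * (s * e)) ≤ 1 / 30 ∧ η * s ^ 2 * α ^ 2 * lam ^ 2 ≤ 1 / 100 ∧
      s ^ 2 * α ≤ 1 / 100 ∧
      u ^ 4 * (α * S ^ 4 / (4 * lam ^ 2) + s ^ 2 * α ^ 2 * S ^ 2 +
        3 * η * α ^ 2 * (90 * s ^ 2 * e ^ 2) * S ^ 2) ≤ 4 * e ^ 2 := by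
  have hτ0 : 0 < τ := by linarith
  have hu0 : 0 < u := by linarith
  have hα0 : 0 < α := by rw [hα]; positivity
  have hk : α * lam = e / (8 * u * s * τ) := by
    rw [hα]
    field_simp
  have hvar : u ^ 4 * (α ^ 2 * S ^ 2) ≤ e ^ 2 / (2048 * s ^ 2 * τ ^ 2) := by
    calc u ^ 4 * (α ^ 2 * S ^ 2) = u ^ 2 * α ^ 2 / 32 * (32 * (S * u) ^ 2) := by ring
      _ ≤ u ^ 2 * α ^ 2 / 32 * lam ^ 2 := by gcongr
      _ = u ^ 2 / 32 * (α * lam) ^ 2 := by ring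
      _ = e ^ 2 / (2048 * s ^ 2 * τ ^ 2) := by
        rw [hk]
        field_simp
        norm_num
  have hτ2 : 1 ≤ τ ^ 2 := one_le_pow₀ hτ
  -- The fourth power of `S` in the clipping bias needs the product of two entries of the threshold.
  have hcube : 256 * τ * u ^ 3 * S ^ 4 ≤ lam ^ 3 * (s * e) := by
    calc 256 * τ * u ^ 3 * S ^ 4 = (8 * τ * u * S ^ 2) * (32 * (S * u) ^ 2) := by ring
      _ ≤ lam * (s * e) * lam ^ 2 := by gcongr
      _ = lam ^ 3 * (s * e) := by ring
  refine ⟨?_, ?_, ?_, ?_⟩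
  · have : η * α * lam * (19 / 2 * (s * e)) = 19 / 640 * (1 / u) := by
      rw [mul_assoc η, hk, hη]
      field_simp
      norm_num
    rw [this]
    have : 1 / u ≤ 1 := (div_le_one hu0).2 hu
    linarith
  · have : η * s ^ 2 * α ^ 2 * lam ^ 2 = 1 / 2560 * (1 / (u ^ 2 * τ)) := by
      rw [mul_assoc, ← mul_pow, hk, hη]
      field_simp
      norm_num
    rw [this]
    have : 1 / (u ^ 2 * τ) ≤ 1 :=
      (div_le_one (by positivity)).2 (one_le_mul_of_one_le_of_one_le (one_le_pow₀ hu) hτ)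
    linarith
  · have h1 : α * (18 * (s * e)) ≤ e / (8 * u * s * τ) := by
      rw [← hk]
      gcongr
    rw [le_div_iff₀ (by positivity)] at h1
    have h2 : 1 ≤ u * τ := one_le_mul_of_one_le_of_one_le hu hτ
    have h3 : s ^ 2 * α * 144 * (u * τ) * e ≤ 1 * e := by linarith
    have h4 := le_of_mul_le_mul_right h3 he
    have h5 : s ^ 2 * α * 144 * 1 ≤ s ^ 2 * α * 144 * (u * τ) := by gcongr
    linarith
  -- The three error sources, namely clipping bias, curvature and the second-order exponential term,
  -- each cost at most `e ^ 2 = Δ` over `T = u ^ 4` steps.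
  · have b1 : u ^ 4 * (α * S ^ 4 / (4 * lam ^ 2)) ≤ e ^ 2 := by
      rw [← mul_div_assoc, div_le_iff₀ (by positivity)]
      have h1 : u ^ 4 * (α * S ^ 4) * (256 * τ * lam) ≤ e ^ 2 * (4 * lam ^ 2) * (256 * τ * lam) := by
        calc u ^ 4 * (α * S ^ 4) * (256 * τ * lam)
            = u * (α * lam) * (256 * τ * u ^ 3 * S ^ 4) := by ring
          _ ≤ u * (α * lam) * (lam ^ 3 * (s * e)) := by
              have : 0 < α * lam := by positivity
              gcongr
          _ = e ^ 2 * lam ^ 3 * (1 / (8 * τ)) := by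
              rw [hk]
              field_simp
          _ ≤ e ^ 2 * lam ^ 3 * (1024 * τ) := by
              gcongr
              rw [div_le_iff₀ (by positivity)]
              linarith
          _ = e ^ 2 * (4 * lam ^ 2) * (256 * τ * lam) := by ring
      exact le_of_mul_le_mul_right h1 (by positivity)
    have b2 : u ^ 4 * (s ^ 2 * α ^ 2 * S ^ 2) ≤ e ^ 2 := by
      calc u ^ 4 * (s ^ 2 * α ^ 2 * S ^ 2) = s ^ 2 * (u ^ 4 * (α ^ 2 * S ^ 2)) := by ring
        _ ≤ s ^ 2 * (e ^ 2 / (2048 * s ^ 2 * τ ^ 2)) := by gcongr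
        _ = e ^ 2 / (2048 * τ ^ 2) := by field_simp
        _ ≤ e ^ 2 := div_le_self (by positivity) (by linarith)
    have b3 : u ^ 4 * (3 * η * α ^ 2 * (90 * s ^ 2 * e ^ 2) * S ^ 2) ≤ e ^ 2 := by
      have hη0 : 0 ≤ η := by rw [hη]; positivity
      calc u ^ 4 * (3 * η * α ^ 2 * (90 * s ^ 2 * e ^ 2) * S ^ 2)
          = 270 * η * s ^ 2 * e ^ 2 * (u ^ 4 * (α ^ 2 * S ^ 2)) := by ring
        _ ≤ 270 * η * s ^ 2 * e ^ 2 * (e ^ 2 / (2048 * s ^ 2 * τ ^ 2)) := by gcongr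
        _ = e ^ 2 * (27 / (8192 * τ)) := by
            rw [hη]
            field_simp
            norm_num
        _ ≤ e ^ 2 * 1 := by
            gcongr
            rw [div_le_iff₀ (by positivity)]
            linarith
        _ = e ^ 2 := mul_one _
    have : 0 ≤ e ^ 2 := by positivity
    linarith

variable {d M R : ℕ} {Ξ Ω : Type*} [MeasurableSpace Ξ] [MeasurableSpace Ω]

/-- The rate of convergence with high probability. -/
theorem one_sub_le_measureReal_average_le {P : Measure Ω} [IsProbabilityMeasure P]
    {D : Measure Ξ} [IsProbabilityMeasure D] {f : EuclideanSpace ℝ (Fin d) → Ξ → ℝ}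
    {am : (Fin M → ℝ) → Fin M} {x₀ : EuclideanSpace ℝ (Fin d)}
    {data : ℕ → Fin M × Fin R → Ω → Ξ} {p σ S L Fmin Δ δ : ℝ} (hR : 0 < R)
    (hf : IsLoss D f) (hn : IsNoise D f p σ) (ham : IsArgmin am) (hF : IsSmooth (popLoss D f) L)
    (hL : 0 < L) (hS : 0 < S) (hvar : ∀ x, medoidNoiseMoment R am D f x ≤ ENNReal.ofReal S ^ 2)
    (hmin : ∀ x, Fmin ≤ popLoss D f x) (hΔ : popLoss D f x₀ - Fmin = Δ)
    (hdata : ∀ t i, Measurable (data t i)) (hlaw : ∀ t i, P.map (data t i) = D)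
    (hind : iIndepFun (fun n : ℕ × (Fin M × Fin R) => data n.1 n.2) P)
    (hδ : 0 < δ) {T : ℕ} (hT : 1 ≤ T) :
    1 - δ ≤ P.real {ω | 1 / (T : ℝ) * ∑ t ∈ Finset.range T,
      ‖∇ (popLoss D f) (iterate am f (stepSize 2 L Δ S δ T) (threshold 2 L Δ S δ T)
        x₀ data t ω)‖ ^ 2 ≤ rateBound 2 L Δ S δ T} := by
  have hΔ0 : 0 ≤ Δ := by rw [← hΔ]; exact sub_nonneg.2 (hmin x₀)
  rcases hΔ0.eq_or_lt with h0 | hpos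
  -- For `Δ = 0` the start is a minimizer and the zero step keeps the run there; division by `√(L *
  -- Δ) = 0` gives `0`, so the first entry of the maximum vanishes.
  · have hstep : stepSize 2 L Δ S δ T = 0 := by simp [stepSize, ← h0]
    have hrate : rateBound 2 L Δ S δ T = 0 := by simp [rateBound, ← h0]
    have hit : ∀ lam t ω, iterate am f 0 lam x₀ data t ω = x₀ := by
      intro lam t ω
      induction t with
      | zero => rfl
      | succ t ih => rw [iterate, zero_smul, sub_zero, ih]
    have hgrad : ∇ (popLoss D f) x₀ = 0 := by
      have := norm_gradient_sq_le hF.differentiable hL hF.lipschitz hmin x₀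
      rw [hΔ, ← h0, mul_zero] at this
      exact norm_eq_zero.1 (pow_eq_zero_iff two_ne_zero |>.1 (le_antisymm this (sq_nonneg _)))
    simp [hstep, hrate, hit, hgrad, hδ.le]
  have hT' : (0 : ℝ) < T := by positivity
  set u := (T : ℝ) ^ (1 / 4 : ℝ) with hu
  have hu1 : 1 ≤ u := Real.one_le_rpow (by exact_mod_cast hT) (by norm_num)
  have hu0 : 0 < u := by linarith
  have hu4 : u ^ 4 = T := by
    rw [hu, ← Real.rpow_mul_natCast hT'.le]
    norm_num
  set τ := tau δ with hτdef
  have hτ : 1 ≤ τ := one_le_tau δ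
  set s := √L with hs
  set e := √Δ with he
  have hs0 : 0 < s := Real.sqrt_pos.2 hL
  have he0 : 0 < e := Real.sqrt_pos.2 hpos
  have hs2 : s ^ 2 = L := Real.sq_sqrt hL.le
  have he2 : e ^ 2 = Δ := Real.sq_sqrt hΔ0
  have hse : √(L * Δ) = s * e := Real.sqrt_mul hL.le _
  have hes : √(Δ * L) = e * s := Real.sqrt_mul hΔ0 _
  have h90 : √(90 * L * Δ) = √90 * (s * e) := by
    rw [mul_assoc, Real.sqrt_mul (by norm_num), hse]
  have h90l : 9 ≤ √90 := Real.le_sqrt_of_sq_le (by norm_num)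
  have h90u : √90 ≤ 19 / 2 := Real.sqrt_le_iff.2 ⟨by norm_num, by norm_num⟩
  have hthr := threshold_two L Δ S δ T
  set lam := threshold 2 L Δ S δ T with hlamdef
  rw [← hu, ← hτdef, hse, h90] at hthr
  have hA' : 8 * τ / (s * e) * u * S ^ 2 ≤ lam :=
    hthr ▸ (le_max_left _ _).trans (le_max_left _ _)
  have hB' : 2 * (√90 * (s * e)) ≤ lam := hthr ▸ (le_max_right _ _).trans (le_max_left _ _)
  have hC' : √32 * S * u ≤ lam := hthr ▸ le_max_right _ _
  have hse0 : 0 < s * e := by positivity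
  have hB : 18 * (s * e) ≤ lam := by nlinarith
  have hlam : 0 < lam := by linarith
  have hA : 8 * τ * u * S ^ 2 ≤ lam * (s * e) := by
    rw [← div_le_iff₀ hse0]
    refine le_trans (le_of_eq ?_) hA'
    ring
  have hC : 32 * (S * u) ^ 2 ≤ lam ^ 2 := by
    have := pow_le_pow_left₀ (by positivity) hC' 2
    rwa [mul_assoc, mul_pow, Real.sq_sqrt (by norm_num)] at this
  have hαeq := stepSize_two L Δ S δ T
  set α := stepSize 2 L Δ S δ T with hαdef
  rw [← hu, ← hlamdef, ← hτdef, ← hs, ← he] at hαeq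
  have hα0 : 0 < α := by rw [hαeq]; positivity
  obtain ⟨p1, p2, p3, p4⟩ := parameter_bounds hs0 he0 hτ hS hu1 hlam hA hB hC hαeq
    (rfl : τ / (40 * e ^ 2) = _)
  set η := τ / (40 * e ^ 2) with hη
  have hη0 : 0 < η := by positivity
  rw [hs2] at p2 p3 p4
  rw [he2, hu4] at p4
  have hbad := measure_sum_gradient_sq_gt_le hR hf hn ham hF hL hS.le hvar hmin hΔ hdata hlaw hind
    hα0.le hlam hη0 T (by rw [h90]; linarith)
    (le_trans (by rw [h90]; gcongr) p1) p2 p3 p4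
  have hητ : 40 * η * Δ = τ := by
    rw [hη, he2]
    field_simp
  rw [hητ] at hbad
  have hbad' := hbad.trans (ENNReal.ofReal_le_ofReal (exp_neg_tau_le hδ))
  set bad := {ω | 45 * Δ < α / 2 * ∑ t ∈ Finset.range T,
      ‖∇ (popLoss D f) (iterate am f α lam x₀ data t ω)‖ ^ 2} with hbaddef
  have hsub : badᶜ ⊆ {ω | 1 / (T : ℝ) * ∑ t ∈ Finset.range T,
      ‖∇ (popLoss D f) (iterate am f α lam x₀ data t ω)‖ ^ 2 ≤ rateBound 2 L Δ S δ T} := by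
    intro ω hω
    simp only [hbaddef, Set.mem_compl_iff, Set.mem_ofPred_eq, not_lt] at hω ⊢
    set G := ∑ t ∈ Finset.range T, ‖∇ (popLoss D f) (iterate am f α lam x₀ data t ω)‖ ^ 2
    have hle : G ≤ 90 * Δ / α := by
      rw [le_div_iff₀ hα0]
      linarith
    -- An equality: `720 = 8 * 90`, with the `8` from the step size.
    have hrate : rateBound 2 L Δ S δ T = 1 / (T : ℝ) * (90 * Δ / α) := by
      rw [rateBound_two L Δ S δ hT, ← hu, ← hlamdef, ← hτdef, hes, hαeq, ← he2, ← hu4]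
      field_simp
      norm_num
    rw [hrate]
    gcongr
  have hcompl : 1 - δ ≤ P.real badᶜ := by
    have h1 : P.real bad ≤ δ := ENNReal.toReal_le_of_le_ofReal hδ.le hbad'
    have h2 : (1 : ℝ) ≤ P.real bad + P.real badᶜ := by
      rw [← probReal_univ (μ := P), ← Set.union_compl_self bad]
      exact measureReal_union_le _ _
    linarith
  exact hcompl.trans (measureReal_mono hsub)

end RCSGD

/-! ### Assembly. -/

open RCSGD in
theorem mainTheorem7 (p σ γ θ : ℝ) (hp : 1 < p) (hσ : 0 < σ)
    (hγ : γ ∈ Set.Ioo (0 : ℝ) (1 / 2)) (hθ : θ ∈ Set.Ioo (0 : ℝ) 1)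
    (M R : ℕ) (hM : 2 / (p * θ * γ) < (M : ℝ)) (hR : 0 < R) :
    ∃ S₀ : ℝ, 0 < S₀ ∧
      ∀ (d : ℕ) (Ξ : Type*) [MeasurableSpace Ξ] (D : Measure Ξ) [IsProbabilityMeasure D]
        (f : EuclideanSpace ℝ (Fin d) → Ξ → ℝ) (L : ℝ)
        (am : (Fin M → ℝ) → Fin M) (x₀ : EuclideanSpace ℝ (Fin d)),
        0 < L → IsLoss D f → IsSmooth (popLoss D f) L → IsNoise D f p σ →
        BddBelow (Set.range (popLoss D f)) → IsArgmin am →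
        (∀ x, medoidNoiseMoment R am D f x ≤ ENNReal.ofReal S₀ ^ 2) ∧
        ∀ S : ℝ, 0 < S → (∀ x, medoidNoiseMoment R am D f x ≤ ENNReal.ofReal S ^ 2) →
        ∀ Δ : ℝ, Δ = popLoss D f x₀ - ⨅ x, popLoss D f x →
        ∀ δ ∈ Set.Ioo (0 : ℝ) 1,
          (∀ (T : ℕ), 1 ≤ T →
            ∀ (Ω : Type*) [MeasurableSpace Ω] (P : Measure Ω) [IsProbabilityMeasure P]
              (data : ℕ → Fin M × Fin R → Ω → Ξ),
              (∀ t i, Measurable (data t i)) → (∀ t i, P.map (data t i) = D) →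
              iIndepFun (fun n : ℕ × (Fin M × Fin R) => data n.1 n.2) P →
              1 - δ ≤ P.real {ω | 1 / (T : ℝ) * ∑ t ∈ Finset.range T,
                ‖∇ (popLoss D f) (iterate am f (stepSize 2 L Δ S δ T) (threshold 2 L Δ S δ T)
                  x₀ data t ω)‖ ^ 2 ≤ rateBound 2 L Δ S δ T}) ∧
          (fun T : ℕ => rateBound 2 L Δ S δ T) =O[atTop]
            (fun T : ℕ => (T : ℝ) ^ (-(1 / 2) : ℝ)) := by
  obtain ⟨hγ0, hγ1⟩ := hγ
  obtain ⟨hθ0, hθ1⟩ := hθ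
  have hp0 : 0 < p := by linarith
  have hM0 : (0 : ℝ) < M := lt_trans (by positivity) hM
  have hMpos : 0 < M := Nat.cast_pos.1 hM0
  -- `m` is the least integer above `γM`: `m - 1` outliers are still tolerated, while `m p > γMp > 2
  -- / θ > 2`.
  obtain ⟨m, hm, hmlt, hmγ⟩ : ∃ m : ℕ, 0 < m ∧ γ * M < m ∧ (m : ℝ) ≤ γ * M + 1 := by
    refine ⟨⌊γ * M⌋₊ + 1, Nat.succ_pos _, ?_, ?_⟩
    · push_cast
      exact Nat.lt_floor_add_one _
    · push_cast
      linarith [Nat.floor_le (by positivity : 0 ≤ γ * M)]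
  have hmM : m ≤ M := by
    have h1 : (m : ℝ) < M + 1 := by nlinarith
    exact Nat.lt_succ_iff.1 (by exact_mod_cast h1)
  have hmp : 2 ≤ m * p := by
    rw [div_lt_iff₀ (by positivity)] at hM
    have h1 : θ * (M * (p * γ)) ≤ 1 * (M * (p * γ)) := by gcongr
    have h2 : γ * M * p ≤ m * p := by gcongr
    linarith
  have hden : 0 < 1 - 2 * γ := by linarith
  have hN : 0 < M.choose m * R ^ M := Nat.mul_pos (Nat.choose_pos hmM) (pow_pos hR M)
  refine ⟨3 / (1 - 2 * γ) * σ * ((M.choose m * R ^ M : ℕ) : ℝ), by positivity, ?_⟩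
  intro d Ξ _ D _ f L am x₀ hL hf hF hn hbdd ham
  refine ⟨medoidNoiseMoment_le hf hn ham hR hσ hγ1 hm hmM hmγ hmp, ?_⟩
  intro S hS hvar Δ hΔ δ hδ
  refine ⟨?_, rateBound_two_isBigO L Δ S δ⟩
  intro T hT Ω _ P _ data hdata hlaw hind
  exact one_sub_le_measureReal_average_le hR hf hn ham hF hL hS hvar (ciInf_le hbdd) hΔ.symm
    hdata hlaw hind hδ.1 hT
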